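/- **Setting.** A payment network is a finite graph $G=(V,E)$ (parallel edges allowed) with capacities $c:E\to\mathbb{R}_{\ge 0}$; fix an orientation of every edge. An escrow configuration $w$ splits the capacity of every edge $e=(u,v)$ between its ends: $w(u,v),w(v,u)\ge 0$ and $w(u,v)+w(v,u)=c(e)$. A transaction of size $k\ge 0$ from $x$ to $y$ succeeds in $w$ if there is a flow carrying $k$ units from $x$ to $y$ that sends at most $w(u,v)$ along every edge from $u$ to $v$; otherwise it fails. Let $n=|V|-1$. A spanning representation is a map $D:E\to\mathbb{R}^n$ such that the signed sum of $D$ along a walk is $0$ if and only if the walk is closed, and such that the vectors of every spanning tree span $\mathbb{R}^n$. The score of $w$ is $S(w)=\sum_{e=(u,v)} w(u,v)D(e)$, summed over the edges in their positive direction. The network state is uniformly distributed: the probability of a set $A$ of configurations is $\mathrm{vol}(S(A))/\mathrm{vol}(S(\text{all configurations}))$. Let $\Gamma(c)=\sum_T\prod_{e\in T}c(e)$, where $T$ runs over the spanning trees of $G$, and let $\Gamma_{x=y}(c)$ be the same polynomial for the graph in which $x$ and $y$ are identified. Assume $\Gamma(c)>0$, i.e. the edges of positive capacity connect all the vertices.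 **Statement.** Let $x\ne y$ be two vertices, let $D$ be any spanning representation, let $f_v(k)$ be the probability that the transaction of size $k\geq 0$ from $x$ to $y$ fails, and put $\rho=\Gamma_{x=y}(c)/\Gamma(c)$. 1. At every $k\ge 0$ the right derivative of $f_v$ exists and lies in $[0,\rho]$, and at every $k>0$ the left derivative of $f_v$ exists and lies in $[0,\rho]$. There is a least $K\ge 0$ with $f_v(K)=1$; it is positive, and $f_v$ is differentiable at every $k>0$ with $k\neq K$. In particular $0\le f_v'(k)\le\rho$ at these $k$. 2. The right derivative of $f_v$ at $0$ equals $\rho$. 3. For every $k\ge 0$ the transaction of size $k$ from $x$ to $y$ succeeds with probability at least $1-k\,\Gamma_{x=y}(c)/\Gamma(c)$. 4. This lower bound is efficiently computable: there is one program for a real random access machine (each exact arithmetic operation $+,-,\times,\div$ on real numbers, each comparison, and each elementary operation on addresses costs one step) that, given $G$ as a list of edges, $c$, $x$, $y$ and $k\ge0$ with $x\neq y$ and $\Gamma(c)>0$, outputs $1-k\,\Gamma_{x=y}(c)/\Gamma(c)$ after a number of steps bounded by a polynomial in $|V|+|E|$. -/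

import Mathlib

namespace CreditNetwork

/-- A (multi)graph with vertex set `V` and edge set `E`. Every edge carries a fixed orientation,
from `src e` to `tgt e`; parallel edges and loops are allowed. -/
structure MGraph (V E : Type*) where
  src : E → V
  tgt : E → V

namespace MGraph

variable {V E : Type*}

/-- Walks of the underlying undirected graph: an edge may be traversed along its orientation
(`fwd`) or against it (`bwd`). -/
inductive Walk (G : MGraph V E) : V → V → Type _
  | nil (u : V) : Walk G u u
  | fwd {v : V} (e : E) (p : Walk G (G.tgt e) v) : Walk G (G.src e) v
  | bwd {v : V} (e : E) (p : Walk G (G.src e) v) : Walk G (G.tgt e) v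

/-- The edges traversed by a walk. -/
def Walk.edges {G : MGraph V E} : {u v : V} → G.Walk u v → List E
  | _, _, .nil _ => []
  | _, _, .fwd e p => e :: p.edges
  | _, _, .bwd e p => e :: p.edges

/-- The direction of a walk under `D`: the signed sum of `D` along the walk. -/
def Walk.direction {G : MGraph V E} {n : ℕ} (D : E → Fin n → ℝ) :
    {u v : V} → G.Walk u v → (Fin n → ℝ)
  | _, _, .nil _ => 0
  | _, _, .fwd e p => D e + p.direction D
  | _, _, .bwd e p => -D e + p.direction D

/-- The edge set `T` connects all vertices. -/
def ConnectedBy (G : MGraph V E) (T : Finset E) : Prop :=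
  ∀ u v : V, ∃ p : G.Walk u v, ∀ e ∈ p.edges, e ∈ T

/-- A spanning tree: a set of `|V| - 1` edges that connects all vertices. -/
def IsSpanningTree (G : MGraph V E) (T : Finset E) : Prop :=
  G.ConnectedBy T ∧ T.card + 1 = Nat.card V

open Classical in
/-- The generating polynomial `Γ(y) = ∑_T ∏_{e ∈ T} y_e` of the spanning trees. -/
noncomputable def treeGen [Fintype E] (G : MGraph V E) (y : E → ℝ) : ℝ :=
  ∑ T : Finset E with G.IsSpanningTree T, ∏ e ∈ T, y e

/-- The graph in which the vertices `a` and `b` are identified. It has the same edges. -/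
def identify (G : MGraph V E) (a b : V) : MGraph (Quot fun u v : V => u = a ∧ v = b) E where
  src e := Quot.mk _ (G.src e)
  tgt e := Quot.mk _ (G.tgt e)

/-- `D` is a spanning representation: a walk has direction `0` exactly if it is closed, and the
vectors of every spanning tree span `ℝⁿ`. -/
structure IsSpanningRepresentation (G : MGraph V E) {n : ℕ} (D : E → Fin n → ℝ) : Prop where
  direction_eq_zero_iff : ∀ (u v : V) (p : G.Walk u v), p.direction D = 0 ↔ u = v
  span_eq_top : ∀ T : Finset E, G.IsSpanningTree T → Submodule.span ℝ (D '' (T : Set E)) = ⊤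

end MGraph

/-- How the escrow on every edge is split: the parts owned by the agent at the source
and by the agent at the target of the edge. -/
structure Escrow (E : Type*) where
  atSrc : E → ℝ
  atTgt : E → ℝ

variable {V E : Type*}

/-- The escrow configurations of the network with capacities `c`. -/
def configurations (c : E → ℝ) : Set (Escrow E) :=
  {w | ∀ e, 0 ≤ w.atSrc e ∧ 0 ≤ w.atTgt e ∧ w.atSrc e + w.atTgt e = c e}

open Classical in
/-- The transaction of size `k` from `x` to `y` succeeds in `w`: some flow takes `k` units from
`x` to `y`, where `fwd e` units are sent over `e` from its source to its target and `bwd e` units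
from its target to its source, and every sender owns what it sends. -/
def Succeeds [Fintype E] (G : MGraph V E) (x y : V) (k : ℝ) (w : Escrow E) : Prop :=
  ∃ fwd bwd : E → ℝ,
    (∀ e, 0 ≤ fwd e ∧ fwd e ≤ w.atSrc e ∧ 0 ≤ bwd e ∧ bwd e ≤ w.atTgt e) ∧
    ∀ z : V,
      (∑ e, ((if G.src e = z then fwd e else 0) + (if G.tgt e = z then bwd e else 0))) -
        (∑ e, ((if G.tgt e = z then fwd e else 0) + (if G.src e = z then bwd e else 0))) =
      (if z = x then k else 0) - (if z = y then k else 0)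

/-- The represented score of an escrow configuration. -/
def score [Fintype E] {n : ℕ} (D : E → Fin n → ℝ) (w : Escrow E) : Fin n → ℝ :=
  ∑ e, w.atSrc e • D e

/-- The probability of a set `A` of configurations under the uniform distribution on network
states: the volume of the image of `A` in `ℝⁿ`, relative to that of the set of all
configurations. -/
noncomputable def prob [Fintype E] {n : ℕ} (D : E → Fin n → ℝ) (c : E → ℝ)
    (A : Set (Escrow E)) : ℝ :=
  MeasureTheory.volume.real (score D '' A) /
    MeasureTheory.volume.real (score D '' configurations c)

/-- The probability that the transaction of size `k` from `x` to `y` succeeds. -/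
noncomputable def successProb [Fintype E] {n : ℕ} (G : MGraph V E) (D : E → Fin n → ℝ)
    (c : E → ℝ) (x y : V) (k : ℝ) : ℝ :=
  prob D c {w ∈ configurations c | Succeeds G x y k w}

/-- The probability that the transaction of size `k` from `x` to `y` fails. -/
noncomputable def failProb [Fintype E] {n : ℕ} (G : MGraph V E) (D : E → Fin n → ℝ)
    (c : E → ℝ) (x y : V) (k : ℝ) : ℝ :=
  prob D c {w ∈ configurations c | ¬ Succeeds G x y k w}

end CreditNetwork

/-! A real random access machine with unit cost. It has registers and a two-dimensional memory
for natural numbers, and registers and a two-dimensional memory for real numbers. -/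

namespace RealRAM

structure State where
  natReg : ℕ → ℕ
  natMem : ℕ → ℕ → ℕ
  realReg : ℕ → ℝ
  realMem : ℕ → ℕ → ℝ

/-- Elementary instructions. The first argument (the first two for a store) is the destination;
all arguments are register numbers, except the literal `a` in `natConst` and `realConst`. -/
inductive Instr
  | natConst (i a : ℕ)
  | natAdd (i j l : ℕ)
  | natSub (i j l : ℕ)
  | natLoad (i j l : ℕ)
  | natStore (i j l : ℕ)
  | realConst (i a : ℕ)
  | realAdd (i j l : ℕ)
  | realSub (i j l : ℕ)
  | realMul (i j l : ℕ)
  | realDiv (i j l : ℕ)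
  | realLoad (i j l : ℕ)
  | realStore (i j l : ℕ)

def State.setNat (s : State) (i a : ℕ) : State :=
  { s with natReg := Function.update s.natReg i a }

def State.setReal (s : State) (i : ℕ) (a : ℝ) : State :=
  { s with realReg := Function.update s.realReg i a }

def State.setNatMem (s : State) (i j a : ℕ) : State :=
  { s with natMem := Function.update s.natMem i (Function.update (s.natMem i) j a) }

def State.setRealMem (s : State) (i j : ℕ) (a : ℝ) : State :=
  { s with realMem := Function.update s.realMem i (Function.update (s.realMem i) j a) }

/-- The effect of an instruction. `natSub` is truncated subtraction. -/
noncomputable def Instr.result (s : State) : Instr → State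
  | .natConst i a => s.setNat i a
  | .natAdd i j l => s.setNat i (s.natReg j + s.natReg l)
  | .natSub i j l => s.setNat i (s.natReg j - s.natReg l)
  | .natLoad i j l => s.setNat i (s.natMem (s.natReg j) (s.natReg l))
  | .natStore i j l => s.setNatMem (s.natReg i) (s.natReg j) (s.natReg l)
  | .realConst i a => s.setReal i a
  | .realAdd i j l => s.setReal i (s.realReg j + s.realReg l)
  | .realSub i j l => s.setReal i (s.realReg j - s.realReg l)
  | .realMul i j l => s.setReal i (s.realReg j * s.realReg l)
  | .realDiv i j l => s.setReal i (s.realReg j / s.realReg l)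
  | .realLoad i j l => s.setReal i (s.realMem (s.natReg j) (s.natReg l))
  | .realStore i j l => s.setRealMem (s.natReg i) (s.natReg j) (s.realReg l)

/-- An instruction can be executed unless it divides by zero. -/
def Instr.Legal (s : State) : Instr → Prop
  | .realDiv _ _ l => s.realReg l ≠ 0
  | _ => True

/-- Comparisons of two natural or two real registers. -/
inductive Test
  | natLt (i j : ℕ)
  | realLt (i j : ℕ)

def Test.Holds (s : State) : Test → Prop
  | .natLt i j => s.natReg i < s.natReg j
  | .realLt i j => s.realReg i < s.realReg j

inductive Program
  | instr (a : Instr)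
  | seq (p q : Program)
  | branch (b : Test) (p q : Program)
  | loop (b : Test) (p : Program)

/-- `Runs p s s' t`: started in state `s`, the program `p` halts in state `s'` after `t` steps.
Every instruction and every evaluation of a test is one step. -/
inductive Runs : Program → State → State → ℕ → Prop
  | instr {a : Instr} {s : State} (h : a.Legal s) : Runs (.instr a) s (a.result s) 1
  | seq {p q : Program} {s s' s'' : State} {t t' : ℕ}
      (hp : Runs p s s' t) (hq : Runs q s' s'' t') : Runs (.seq p q) s s'' (t + t')
  | branchTrue {b : Test} {p q : Program} {s s' : State} {t : ℕ}
      (hb : b.Holds s) (hp : Runs p s s' t) : Runs (.branch b p q) s s' (1 + t)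
  | branchFalse {b : Test} {p q : Program} {s s' : State} {t : ℕ}
      (hb : ¬ b.Holds s) (hq : Runs q s s' t) : Runs (.branch b p q) s s' (1 + t)
  | loopFalse {b : Test} {p : Program} {s : State}
      (hb : ¬ b.Holds s) : Runs (.loop b p) s s 1
  | loopTrue {b : Test} {p : Program} {s s' s'' : State} {t t' : ℕ}
      (hb : b.Holds s) (hp : Runs p s s' t) (hl : Runs (.loop b p) s' s'' t') :
      Runs (.loop b p) s s'' (1 + t + t')

/-- The input of the machine: a graph with vertices `0, …, N - 1` and edges `0, …, m - 1`, its
capacities, two vertices `x` and `y`, and a real number `k`. The natural registers `0` to `3`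
hold `N, m, x, y`, the rows `0` and `1` of the natural memory list the sources and the targets of
the edges, row `0` of the real memory lists the capacities, the real register `0` holds `k`, and
everything else is `0`. -/
noncomputable def input {N m : ℕ} (G : CreditNetwork.MGraph (Fin N) (Fin m)) (c : Fin m → ℝ)
    (x y : Fin N) (k : ℝ) : State where
  natReg i := if i = 0 then N else if i = 1 then m else if i = 2 then x else if i = 3 then y else 0
  natMem r e :=
    if h : e < m then
      if r = 0 then G.src ⟨e, h⟩ else if r = 1 then G.tgt ⟨e, h⟩ else 0
    else 0
  realReg i := if i = 0 then k else 0
  realMem r e := if h : e < m then if r = 0 then c ⟨e, h⟩ else 0 else 0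

end RealRAM

/-! Number the vertices other than `x`, with `y` first. The incidence vectors of the edges in these
coordinates serve as a model: every spanning representation is their image under a linear
automorphism (`exists_linearEquiv`). Probabilities are ratios of volumes, so the automorphism
cancels (`prob_eq`). In the model the scores fill the zonotope `Z = ∑ e, [0, c e] • v e`, and
executing a transaction of size `k` subtracts `k` times the first unit vector from the score. The
transaction succeeds exactly if the shifted score is still in `Z` (`succeeds_iff`). Hence failure is
the part of a convex body that leaves it under a translation.

Let `M s` be the volume of the set of base points over which `Z` has a chord of length at least `s`
in the first direction (`fiberShift`). On every line the part that leaves has length `min k (chord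
length)`, so by Fubini its total volume is the integral of `M` over `[0, k]`
(`measure_diff_translate_eq_lintegral`). `M` is antitone, vanishes after the maximal chord length
`K`, and `M 0` is the volume of the shadow of `Z`. By convexity `M` decays before `K` at most like a
power of `K - s` (`Convex.measure_fiberShift_ge`), so it is continuous and positive there. One-sided
derivatives are thus one-sided limits of `M`, a kink is possible only at `K`, the slope at `0` is `M
0`, and the linear bound is `M ≤ M 0`.

The volume of a zonotope is the weighted sum of the absolute maximal minors
(`factorial_mul_volume_zonotope`). For incidence vectors these are `1` for spanning trees and `0`
otherwise, so `Z` has volume `Γ(c)`. Dropping the coordinate of `y` gives the incidence vectors of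
the graph with `x` and `y` identified, so the shadow has volume `Γ_{x=y}(c)`. This yields `ρ` as the
initial slope.

For the computation, Cauchy-Binet turns the same minors into the matrix-tree theorem
(`det_laplacian_eq_treeGen`). By Cramer's rule `ρ` is then the diagonal entry at `y` of the inverse
reduced Laplacian, the effective resistance between `x` and `y`. Eliminating all other vertices by
Schur complements leaves `1 / ρ` in the entry at `(y, y)`. Positive definiteness keeps the pivots
positive, so no pivot search is needed, and a cubic number of steps suffices. -/

section

/-! ### Primitives of antitone functions with controlled decay. -/

open MeasureTheory Set Filter Topology

/-- An antitone function that decays at most like `(K - s) ^ m` is continuous before `K`. -/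
theorem continuousAt_of_antitone_of_pow_le {M : ℝ → ℝ} {K : ℝ} {m : ℕ} (hM : Antitone M)
    (hpow : ∀ a b, a ≤ b → b < K → ((K - b) / (K - a)) ^ m * M a ≤ M b) (hnn : ∀ s, 0 ≤ M s)
    {k : ℝ} (hk : k < K) : ContinuousAt M k := by
  have hKk : K - k ≠ 0 := by linarith
  have hr : Tendsto (fun s => ((K - s) / (K - k)) ^ m) (𝓝 k) (𝓝 1) := by
    have : ContinuousAt (fun s => ((K - s) / (K - k)) ^ m) k := by fun_prop
    simpa [ContinuousAt, div_self hKk] using this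
  -- One squeeze serves both sides of `k`: on either side one bound is monotonicity and the other
  -- the power estimate, and `min 1`, `max 1` cover both.
  have hlo : Tendsto (fun s => min 1 (((K - s) / (K - k)) ^ m) * M k) (𝓝 k) (𝓝 (M k)) := by
    simpa using ((tendsto_const_nhds (x := (1 : ℝ))).min hr).mul_const (M k)
  have hhi : Tendsto (fun s => max 1 (((K - s) / (K - k)) ^ m) * M k) (𝓝 k) (𝓝 (M k)) := by
    simpa using ((tendsto_const_nhds (x := (1 : ℝ))).max hr).mul_const (M k)
  refine tendsto_of_tendsto_of_tendsto_of_le_of_le' hlo hhi ?_ ?_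
  · filter_upwards [Iio_mem_nhds hk] with s hs
    rcases le_total s k with h | h
    · calc _ ≤ 1 * M k := mul_le_mul_of_nonneg_right (min_le_left _ _) (hnn k)
        _ ≤ M s := by simpa using hM h
    · exact (mul_le_mul_of_nonneg_right (min_le_right _ _) (hnn k)).trans (hpow k s h hs)
  · filter_upwards [Iio_mem_nhds hk] with s hs
    rcases le_total s k with h | h
    · refine le_trans ?_ (mul_le_mul_of_nonneg_right (le_max_right _ _) (hnn k))
      have hs : 0 < K - s := by have : s < K := hs; linarith
      have hk' : 0 < K - k := by linarith
      have h1 := hpow s k h hk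
      have h2 : ((K - s) / (K - k)) ^ m * ((K - k) / (K - s)) ^ m = 1 := by
        rw [← mul_pow, div_mul_div_cancel₀ hKk, div_self hs.ne', one_pow]
      calc M s = ((K - s) / (K - k)) ^ m * (((K - k) / (K - s)) ^ m * M s) := by
              rw [← mul_assoc, h2, one_mul]
        _ ≤ _ := mul_le_mul_of_nonneg_left h1 (by positivity)
    · calc M s ≤ 1 * M k := by simpa using hM h
        _ ≤ _ := mul_le_mul_of_nonneg_right (le_max_left _ _) (hnn k)

/-- The properties of a primitive of an antitone function that vanishes after `K` and decays at
most like `(K - s) ^ m` before `K`. -/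
theorem primitive_of_antitone_properties {M F : ℝ → ℝ} {K V : ℝ} {m : ℕ} (hM : Antitone M)
    (hpow : ∀ a b, a ≤ b → b < K → ((K - b) / (K - a)) ^ m * M a ≤ M b) (hnn : ∀ s, 0 ≤ M s)
    (hneg : ∀ s ≤ 0, M s = M 0)
    (hzero : ∀ s, K < s → M s = 0) (hK : 0 ≤ K) (hV : 0 < V)
    (hF : ∀ k, 0 ≤ k → F k = ∫ s in (0)..k, M s) (hFV : ∀ k, K < k → F k = V) :
    (∀ k : ℝ, 0 ≤ k → ∃ d : ℝ, HasDerivWithinAt F d (Ici k) k ∧ 0 ≤ d ∧ d ≤ M 0) ∧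
    (∀ k : ℝ, 0 < k → ∃ d : ℝ, HasDerivWithinAt F d (Iic k) k ∧ 0 ≤ d ∧ d ≤ M 0) ∧
    (∃ K : ℝ, 0 < K ∧ IsLeast {k : ℝ | 0 ≤ k ∧ F k = V} K ∧
      ∀ k : ℝ, 0 < k → k ≠ K → DifferentiableAt ℝ F k) ∧
    HasDerivWithinAt F (M 0) (Ici 0) 0 ∧
    (∀ k : ℝ, 0 ≤ k → F k ≤ k * M 0) := by
  have hle : ∀ s, M s ≤ M 0 := fun s => by
    rcases le_total s 0 with h | h
    · exact (hneg s h).le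
    · exact hM h
  have hint : ∀ a b, IntervalIntegrable M volume a b := fun a b => hM.intervalIntegrable
  have hmeas : StronglyMeasurable M := hM.measurable.stronglyMeasurable
  have hsm : ∀ l : Filter ℝ, StronglyMeasurableAtFilter M l volume := fun l =>
    ⟨univ, univ_mem, hmeas.aestronglyMeasurable⟩
  have hFle : ∀ k : ℝ, 0 ≤ k → F k ≤ k * M 0 := fun k hk => by
    rw [hF k hk]
    calc ∫ s in (0)..k, M s ≤ ∫ s in (0)..k, M 0 :=
          intervalIntegral.integral_mono_on hk (hint _ _) intervalIntegrable_const
            fun s _ => hle s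
      _ = k * M 0 := by simp
  have hright : ∀ k : ℝ, 0 ≤ k → ∀ d, Tendsto M (𝓝[>] k) (𝓝 d) →
      HasDerivWithinAt F d (Ici k) k := fun k hk d hd =>
    (intervalIntegral.integral_hasDerivWithinAt_of_tendsto_ae_right (hint 0 k) (hsm _)
      (hd.mono_left inf_le_left)).congr (fun s hs => hF s (hk.trans hs)) (hF k hk)
  have hev : ∀ k : ℝ, 0 < k → F =ᶠ[𝓝 k] fun u => ∫ s in (0)..u, M s := fun k hk => by
    filter_upwards [Ioi_mem_nhds hk] with s hs using hF s (le_of_lt hs)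
  have hKpos : 0 < K := by
    rcases hK.lt_or_eq with h | h
    · exact h
    · exfalso
      have h1 : F 1 = 0 := by
        rw [hF 1 zero_le_one, intervalIntegral.integral_of_le zero_le_one]
        rw [setIntegral_congr_fun (g := fun _ => (0 : ℝ)) measurableSet_Ioc
          fun s hs => hzero s (h ▸ hs.1)]
        simp
      rw [hFV 1 (h ▸ zero_lt_one)] at h1
      exact hV.ne' h1
  have hFK : F K = V := by
    have h1 : ∫ s in K..(K + 1), M s = 0 := by
      rw [intervalIntegral.integral_of_le (by linarith)]
      rw [setIntegral_congr_fun (g := fun _ => (0 : ℝ)) measurableSet_Ioc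
        fun s hs => hzero s hs.1]
      simp
    have h2 := intervalIntegral.integral_add_adjacent_intervals (hint 0 K) (hint K (K + 1))
    rw [h1, add_zero, ← hF K hK, ← hF (K + 1) (by linarith), hFV (K + 1) (by linarith)] at h2
    exact h2
  have hM0 : 0 < M 0 := by
    have := hFle K hK
    rw [hFK] at this
    by_contra h
    nlinarith [hnn 0]
  have hcont : ∀ k < K, ContinuousAt M k := fun k hk =>
    continuousAt_of_antitone_of_pow_le hM hpow hnn hk
  refine ⟨fun k hk => ?_, fun k hk => ?_, ⟨K, hKpos, ⟨⟨hK, hFK⟩, fun k hk => ?_⟩, ?_⟩, ?_, hFle⟩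
  · have h := hM.tendsto_nhdsGT k
    refine ⟨_, hright k hk _ h, ge_of_tendsto h (.of_forall hnn), le_of_tendsto h (.of_forall hle)⟩
  · have h := hM.tendsto_nhdsLT k
    -- The single point `k` is null, so the value `M k` is irrelevant and the limit from strictly
    -- below suffices.
    have hae : 𝓝[≤] k ⊓ ae volume ≤ 𝓝[<] k := by
      refine le_inf (inf_le_left.trans inf_le_left) (le_principal_iff.2 ?_)
      refine mem_of_superset (inter_mem_inf self_mem_nhdsWithin
        (compl_mem_ae_iff.2 (measure_singleton k))) fun s hs => lt_of_le_of_ne hs.1 hs.2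
    refine ⟨_, HasDerivWithinAt.congr_of_eventuallyEq
      (intervalIntegral.integral_hasDerivWithinAt_of_tendsto_ae_right (hint 0 k) (hsm _)
      (h.mono_left hae)) ((hev k hk).filter_mono nhdsWithin_le_nhds) (hF k hk.le),
      ge_of_tendsto h (.of_forall hnn), le_of_tendsto h (.of_forall hle)⟩
  · by_contra! hlt
    -- If `F` reached `V` at `k < K`, the integral over `[k, K]` would vanish. But the decay
    -- estimate from `0` makes `M` positive at the midpoint `b`, hence bounded below on `[k, b]`.
    set b := (k + K) / 2 with hb
    have hMb : 0 < M b := by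
      refine lt_of_lt_of_le ?_ (hpow 0 b (by linarith [hk.1]) (by linarith))
      have : 0 < (K - b) / (K - 0) := div_pos (by linarith) (by linarith)
      positivity
    have h2 := intervalIntegral.integral_add_adjacent_intervals (hint 0 k) (hint k b)
    have h3 := intervalIntegral.integral_add_adjacent_intervals (hint 0 b) (hint b K)
    have h4 : 0 ≤ ∫ s in b..K, M s :=
      intervalIntegral.integral_nonneg (by linarith) fun s _ => hnn s
    have h5 : (b - k) * M b ≤ ∫ s in k..b, M s := by
      calc (b - k) * M b = ∫ s in k..b, M b := by simp
        _ ≤ _ := intervalIntegral.integral_mono_on (by linarith) intervalIntegrable_const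
          (hint _ _) fun s hs => hM hs.2
    rw [← hF k hk.1, hk.2] at h2
    rw [← hF K hK, hFK] at h3
    have : 0 < (b - k) * M b := mul_pos (by linarith) hMb
    linarith
  · intro k hk hne
    rcases hne.lt_or_gt with h | h
    · exact (((intervalIntegral.integral_hasDerivAt_right (hint 0 k) (hsm _)
        (hcont k h)).congr_of_eventuallyEq (hev k hk))).differentiableAt
    · have : F =ᶠ[𝓝 k] fun _ => V := by
        filter_upwards [Ioi_mem_nhds h] with s hs using hFV s hs
      exact this.differentiableAt_iff.2 (differentiableAt_const _)
  · exact hright 0 le_rfl _ ((hcont 0 hKpos).tendsto.mono_left nhdsWithin_le_nhds)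

end

/-! ### Translating a convex body in the first direction. -/

section

open MeasureTheory Set Filter Topology
open scoped ENNReal

theorem IsCompact.exists_eq_Icc_of_convex {I : Set ℝ} (hI : IsCompact I) (hc : Convex ℝ I)
    (hne : I.Nonempty) : ∃ a b, a ≤ b ∧ I = Icc a b := by
  have h := eq_Icc_of_connected_compact (hc.isConnected hne) hI
  refine ⟨_, _, ?_, h⟩
  exact nonempty_Icc.1 (h ▸ hne)

/-- For an interval of length `ℓ` both sides are `min k ℓ`. -/
theorem volume_diff_translate_eq {I : Set ℝ} (hI : IsCompact I) (hc : Convex ℝ I) {k : ℝ}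
    (hk : 0 ≤ k) :
    volume {t | t ∈ I ∧ t - k ∉ I} = volume {s | s ∈ Ioc 0 k ∧ ∃ t ∈ I, t + s ∈ I} := by
  rcases I.eq_empty_or_nonempty with rfl | hne
  · simp
  obtain ⟨a, b, hab, rfl⟩ := hI.exists_eq_Icc_of_convex hc hne
  have h2 : {s | s ∈ Ioc 0 k ∧ ∃ t ∈ Icc a b, t + s ∈ Icc a b} = Ioc 0 (min k (b - a)) := by
    ext s
    simp only [mem_ofPred_eq, mem_Ioc, mem_Icc, le_min_iff]
    constructor
    · rintro ⟨⟨h1, h2⟩, t, h3, h4⟩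
      exact ⟨h1, h2, by linarith⟩
    · rintro ⟨h1, h2, h3⟩
      exact ⟨⟨h1, h2⟩, a, by constructor <;> linarith, by constructor <;> linarith⟩
  rw [h2, Real.volume_Ioc]
  rcases le_or_gt k (b - a) with h | h
  · have h1 : {t | t ∈ Icc a b ∧ t - k ∉ Icc a b} = Ico a (a + k) := by
      ext t
      simp only [mem_ofPred_eq, mem_Icc, mem_Ico, not_and, not_le]
      constructor
      · rintro ⟨h1, h2⟩
        refine ⟨h1.1, ?_⟩
        by_contra hh
        linarith [h2 (by linarith)]
      · rintro ⟨h1, h2⟩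
        exact ⟨⟨h1, by linarith⟩, fun h3 => by linarith⟩
    rw [h1, Real.volume_Ico, min_eq_left h]
    congr 1; ring
  · have h1 : {t | t ∈ Icc a b ∧ t - k ∉ Icc a b} = Icc a b := by
      ext t
      simp only [mem_ofPred_eq, mem_Icc, not_and, not_le]
      constructor
      · exact fun h => h.1
      · exact fun h => ⟨h, fun h3 => by linarith⟩
    rw [h1, Real.volume_Icc, min_eq_right h.le]
    congr 1; ring

theorem volume_add_Icc {I : Set ℝ} (hI : IsCompact I) (hc : Convex ℝ I) (hne : I.Nonempty) {a : ℝ}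
    (ha : 0 ≤ a) :
    volume {t | ∃ r ∈ Icc 0 a, t - r ∈ I} = volume I + ENNReal.ofReal a := by
  obtain ⟨u, v, huv, rfl⟩ := hI.exists_eq_Icc_of_convex hc hne
  have h1 : {t | ∃ r ∈ Icc 0 a, t - r ∈ Icc u v} = Icc u (v + a) := by
    ext t
    simp only [mem_ofPred_eq, mem_Icc]
    constructor
    · rintro ⟨r, h1, h2⟩
      constructor <;> linarith
    · rintro ⟨h1, h2⟩
      rcases le_total t v with h | h
      · exact ⟨0, by constructor <;> linarith, by constructor <;> linarith⟩
      · exact ⟨t - v, by constructor <;> linarith, by constructor <;> linarith⟩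
  rw [h1, Real.volume_Icc, Real.volume_Icc, ← ENNReal.ofReal_add (by linarith) ha]
  congr 1; ring

section Fiber

variable {W : Type*}

/-- The points over which `Z` contains two points at distance `s`. -/
def fiberShift (Z : Set (ℝ × W)) (s : ℝ) : Set W :=
  {p | ∃ t, (t, p) ∈ Z ∧ (t + s, p) ∈ Z}

theorem fiberShift_zero (Z : Set (ℝ × W)) : fiberShift Z 0 = Prod.snd '' Z := by
  ext p
  simp [fiberShift]

variable [NormedAddCommGroup W]

/-- The set is a continuous image of the pairs of points of `Z` with equal base point. Its
compactness gives the joint measurability for Fubini and the existence of a longest chord. -/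
theorem isCompact_fiberShift_graph {Z : Set (ℝ × W)} (hZ : IsCompact Z) :
    IsCompact {q : ℝ × W | q.2 ∈ fiberShift Z q.1} := by
  have h : IsCompact ((Z ×ˢ Z) ∩ {z : (ℝ × W) × (ℝ × W) | z.1.2 = z.2.2}) :=
    (hZ.prod hZ).inter_right (isClosed_eq (by fun_prop) (by fun_prop))
  convert h.image (f := fun z => (z.2.1 - z.1.1, z.1.2)) (by fun_prop) using 1
  ext ⟨s, p⟩
  simp only [fiberShift, mem_ofPred_eq, mem_image, mem_inter_iff, mem_prod, Prod.exists,
    Prod.mk.injEq]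
  constructor
  · rintro ⟨t, h1, h2⟩
    exact ⟨t, p, t + s, p, ⟨⟨h1, h2⟩, rfl⟩, by ring, rfl⟩
  · rintro ⟨t, p', t', p'', ⟨⟨h1, h2⟩, rfl⟩, rfl, rfl⟩
    exact ⟨t, h1, by simpa using h2⟩

theorem isCompact_fiberShift {Z : Set (ℝ × W)} (hZ : IsCompact Z) (s : ℝ) :
    IsCompact (fiberShift Z s) := by
  have h : IsCompact ({q : ℝ × W | q.2 ∈ fiberShift Z q.1} ∩ {q | q.1 = s}) :=
    (isCompact_fiberShift_graph hZ).inter_right (isClosed_eq (by fun_prop) (by fun_prop))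
  convert h.image (f := Prod.snd) continuous_snd using 1
  ext p
  simp

theorem IsCompact.preimage_prodMk {Z : Set (ℝ × W)} (hZ : IsCompact Z) (p : W) :
    IsCompact ((fun t => (t, p)) ⁻¹' Z) := by
  have h : IsCompact (Z ∩ {q | q.2 = p}) :=
    hZ.inter_right (isClosed_eq (by fun_prop) (by fun_prop))
  convert h.image (f := Prod.fst) continuous_fst using 1
  ext t
  simp

variable [NormedSpace ℝ W]

/-- Convex combinations of the two end points of two chords bound a chord again. This is the only
source of regularity in the length. -/
theorem Convex.fiberShift_combination {Z : Set (ℝ × W)} (hZ : Convex ℝ Z) {a b : ℝ} {p q : W}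
    (hp : p ∈ fiberShift Z a) (hq : q ∈ fiberShift Z b) {u v : ℝ} (hu : 0 ≤ u) (hv : 0 ≤ v)
    (huv : u + v = 1) : u • p + v • q ∈ fiberShift Z (u * a + v * b) := by
  obtain ⟨t, h1, h2⟩ := hp
  obtain ⟨t', h1', h2'⟩ := hq
  refine ⟨u * t + v * t', ?_, ?_⟩
  · simpa using hZ h1 h1' hu hv huv
  · convert hZ h2 h2' hu hv huv using 1
    simp only [Prod.smul_mk, smul_eq_mul, Prod.mk_add_mk, Prod.mk.injEq, and_true]
    ring

/-- A chord is shortened by combining it with a degenerate chord over the same base point. -/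
theorem Convex.fiberShift_anti {Z : Set (ℝ × W)} (hZ : Convex ℝ Z) {a b : ℝ} (ha : 0 ≤ a)
    (hab : a ≤ b) : fiberShift Z b ⊆ fiberShift Z a := by
  rintro p ⟨t, h1, h2⟩
  have h0 : p ∈ fiberShift Z 0 := ⟨t, h1, by simpa using h1⟩
  rcases ha.eq_or_lt with rfl | ha
  · exact h0
  have hb : 0 < b := ha.trans_le hab
  have := hZ.fiberShift_combination ⟨t, h1, h2⟩ h0 (u := a / b) (v := 1 - a / b) (by positivity)
    (by rw [sub_nonneg, div_le_one hb]; exact hab) (by ring)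
  rwa [← add_smul, add_sub_cancel, one_smul, mul_zero, add_zero, div_mul_cancel₀ _ hb.ne'] at this

theorem Convex.preimage_prodMk {Z : Set (ℝ × W)} (hZ : Convex ℝ Z) (p : W) :
    Convex ℝ ((fun t => (t, p)) ⁻¹' Z) := by
  intro a ha b hb u v hu hv huv
  have := hZ ha hb hu hv huv
  simpa [← add_smul, huv] using this

variable [FiniteDimensional ℝ W] [MeasurableSpace W] [BorelSpace W] (μ : Measure W)
  [μ.IsAddHaarMeasure]

/-- Fubini twice: the set of pairs `(s, p)` with `s ∈ (0, k]` and a chord of length `s` over `p` is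
sliced once by `s` and once by `p`. The slices by `p` match by `volume_diff_translate_eq`. -/
theorem measure_diff_translate_eq_lintegral {Z : Set (ℝ × W)} (hZ : IsCompact Z)
    (hc : Convex ℝ Z) {k : ℝ} (hk : 0 ≤ k) :
    (volume.prod μ) {z : ℝ × W | z ∈ Z ∧ (z.1 - k, z.2) ∉ Z} =
      ∫⁻ s in Ioc 0 k, μ (fiberShift Z s) := by
  have hm1 : MeasurableSet {z : ℝ × W | z ∈ Z ∧ (z.1 - k, z.2) ∉ Z} := by
    refine hZ.measurableSet.inter (MeasurableSet.compl ?_)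
    exact (hZ.isClosed.preimage (f := fun z : ℝ × W => (z.1 - k, z.2)) (by fun_prop)).measurableSet
  have hm2 : MeasurableSet {q : ℝ × W | q.1 ∈ Ioc 0 k ∧ q.2 ∈ fiberShift Z q.1} :=
    (measurable_fst measurableSet_Ioc).inter (isCompact_fiberShift_graph hZ).measurableSet
  have h2 : (volume.prod μ) {q : ℝ × W | q.1 ∈ Ioc 0 k ∧ q.2 ∈ fiberShift Z q.1} =
      ∫⁻ s in Ioc 0 k, μ (fiberShift Z s) := by
    rw [Measure.prod_apply hm2, ← lintegral_indicator measurableSet_Ioc]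
    refine lintegral_congr fun s => ?_
    by_cases hs : s ∈ Ioc 0 k
    · rw [indicator_of_mem hs]
      congr 1
      ext p
      simp [mem_Ioc.1 hs]
    · rw [indicator_of_notMem hs]
      have : Prod.mk s ⁻¹' {q : ℝ × W | q.1 ∈ Ioc 0 k ∧ q.2 ∈ fiberShift Z q.1} = ∅ := by
        ext p
        simp only [mem_preimage, mem_ofPred_eq, mem_empty_iff_false, iff_false, not_and]
        exact fun h => absurd h hs
      rw [this, measure_empty]
  rw [← h2, Measure.prod_apply_symm hm1, Measure.prod_apply_symm hm2]
  refine lintegral_congr fun p => ?_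
  exact volume_diff_translate_eq (hZ.preimage_prodMk p) (hc.preimage_prodMk p) hk

/-- Every line that meets `Z` meets it in an interval, which the sweep lengthens by `a`; the other
lines stay empty. -/
theorem measure_add_segment {Z : Set (ℝ × W)} (hZ : IsCompact Z)
    (hc : Convex ℝ Z) {a : ℝ} (ha : 0 ≤ a) :
    (volume.prod μ) {z : ℝ × W | ∃ r ∈ Icc 0 a, (z.1 - r, z.2) ∈ Z} =
      (volume.prod μ) Z + ENNReal.ofReal a * μ (Prod.snd '' Z) := by
  have hm1 : MeasurableSet {z : ℝ × W | ∃ r ∈ Icc 0 a, (z.1 - r, z.2) ∈ Z} := by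
    have := ((hZ.prod (isCompact_Icc (a := (0 : ℝ)) (b := a))).image
      (f := fun q : (ℝ × W) × ℝ => (q.1.1 + q.2, q.1.2)) (by fun_prop)).measurableSet
    convert this using 1
    ext ⟨t, p⟩
    simp only [mem_ofPred_eq, mem_image, mem_prod, Prod.exists, Prod.mk.injEq]
    constructor
    · rintro ⟨r, hr, h⟩
      exact ⟨t - r, p, r, ⟨h, hr⟩, by ring, rfl⟩
    · rintro ⟨t', p', r, ⟨h, hr⟩, rfl, rfl⟩
      exact ⟨r, hr, by simpa using h⟩
  have hm2 : MeasurableSet (Prod.snd '' Z) := (hZ.image continuous_snd).measurableSet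
  rw [Measure.prod_apply_symm hm1, Measure.prod_apply_symm hZ.measurableSet,
    ← lintegral_indicator_const hm2, ← lintegral_add_right _ (measurable_const.indicator hm2)]
  refine lintegral_congr fun p => ?_
  by_cases hp : p ∈ Prod.snd '' Z
  · rw [indicator_of_mem hp]
    refine volume_add_Icc (hZ.preimage_prodMk p) (hc.preimage_prodMk p) ?_ ha
    obtain ⟨⟨t, _⟩, h, rfl⟩ := hp
    exact ⟨t, h⟩
  · have h1 : ∀ t, (t, p) ∉ Z := fun t ht => hp ⟨(t, p), ht, rfl⟩
    rw [indicator_of_notMem hp]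
    simp [preimage, h1]

/-- The homothety of ratio `u` centred at the base point of a chord of length `K` maps the first set
into the second, and scales its measure by `u` to the dimension. With `u = (K - b) / (K - a)` this
is the decay estimate. -/
theorem Convex.measure_fiberShift_ge {Z : Set (ℝ × W)} (hZ : IsCompact Z) (hc : Convex ℝ Z)
    {a K u : ℝ} (hK : (fiberShift Z K).Nonempty) (hu : 0 ≤ u) (hu1 : u ≤ 1) :
    u ^ Module.finrank ℝ W * μ.real (fiberShift Z a) ≤
      μ.real (fiberShift Z (u * a + (1 - u) * K)) := by
  obtain ⟨q, hq⟩ := hK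
  have h1 : μ.real (AffineMap.homothety q u '' fiberShift Z a) =
      u ^ Module.finrank ℝ W * μ.real (fiberShift Z a) := by
    rw [measureReal_def, Measure.addHaar_image_homothety, ENNReal.toReal_mul,
      ENNReal.toReal_ofReal (abs_nonneg _), abs_of_nonneg (by positivity), measureReal_def]
  rw [← h1]
  refine measureReal_mono ?_ (isCompact_fiberShift hZ _).measure_lt_top.ne
  rintro _ ⟨p, hp, rfl⟩
  convert hc.fiberShift_combination hp hq hu (sub_nonneg.2 hu1) (by ring) using 1
  simp only [AffineMap.homothety_apply, vsub_eq_sub, vadd_eq_add, smul_sub, sub_smul, one_smul]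
  abel

/-- The measure of the part of a convex body that leaves it under a translation by `-k`, as a
function of `k`. -/
theorem measure_diff_translate_properties {Z : Set (ℝ × W)} (hZ : IsCompact Z) (hc : Convex ℝ Z)
    (hpos : 0 < (volume.prod μ).real Z) {F : ℝ → ℝ}
    (hF : ∀ k, 0 ≤ k → F k = (volume.prod μ).real {z : ℝ × W | z ∈ Z ∧ (z.1 - k, z.2) ∉ Z}) :
    (∀ k : ℝ, 0 ≤ k → ∃ d : ℝ, HasDerivWithinAt F d (Ici k) k ∧ 0 ≤ d ∧
      d ≤ μ.real (Prod.snd '' Z)) ∧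
    (∀ k : ℝ, 0 < k → ∃ d : ℝ, HasDerivWithinAt F d (Iic k) k ∧ 0 ≤ d ∧
      d ≤ μ.real (Prod.snd '' Z)) ∧
    (∃ K : ℝ, 0 < K ∧ IsLeast {k : ℝ | 0 ≤ k ∧ F k = (volume.prod μ).real Z} K ∧
      ∀ k : ℝ, 0 < k → k ≠ K → DifferentiableAt ℝ F k) ∧
    HasDerivWithinAt F (μ.real (Prod.snd '' Z)) (Ici 0) 0 ∧
    (∀ k : ℝ, 0 ≤ k → F k ≤ k * μ.real (Prod.snd '' Z)) := by
  have hne : Z.Nonempty := by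
    rw [nonempty_iff_ne_empty]
    rintro rfl
    simp at hpos
  obtain ⟨K, hK, hKne, hKmax⟩ : ∃ K, 0 ≤ K ∧ (fiberShift Z K).Nonempty ∧
      ∀ s, K < s → fiberShift Z s = ∅ := by
    -- `K` is the maximal chord length, attained on the compact set of pairs of length and base
    -- point.
    have hcomp := isCompact_fiberShift_graph hZ
    obtain ⟨z, hz⟩ := hne
    have h0 : ((0 : ℝ), z.2) ∈ {q : ℝ × W | q.2 ∈ fiberShift Z q.1} :=
      ⟨z.1, hz, by simpa using hz⟩
    obtain ⟨q, hq, hmax⟩ := hcomp.exists_isMaxOn ⟨_, h0⟩ continuous_fst.continuousOn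
    refine ⟨q.1, hmax h0, ⟨q.2, hq⟩, fun s hs => ?_⟩
    rw [eq_empty_iff_forall_notMem]
    intro p hp
    exact absurd (hmax (show (s, p) ∈ {q : ℝ × W | q.2 ∈ fiberShift Z q.1} from hp)) (not_le.2 hs)
  have hfin : ∀ s, μ (fiberShift Z s) ≠ ∞ := fun s => (isCompact_fiberShift hZ s).measure_lt_top.ne
  -- `fiberShift` depends only on the absolute value of the length, so its measure is even in `s`;
  -- freezing it for `s ≤ 0` makes it antitone on all of `ℝ`.
  set M : ℝ → ℝ := fun s => μ.real (fiberShift Z (max s 0)) with hMdef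
  have hM0 : M 0 = μ.real (Prod.snd '' Z) := by simp [hMdef, fiberShift_zero]
  have hanti : Antitone M := fun a b hab =>
    measureReal_mono (hc.fiberShift_anti (le_max_right _ _) (max_le_max hab le_rfl)) (hfin _)
  have hnn : ∀ s, 0 ≤ M s := fun s => measureReal_nonneg
  rw [← hM0]
  refine primitive_of_antitone_properties (m := Module.finrank ℝ W) hanti ?_ hnn ?_ (K := K) ?_ hK
    hpos ?_ ?_
  · intro a b hab hbK
    have hd : ∀ a, a ≤ b → 0 ≤ (K - b) / (K - a) ∧ (K - b) / (K - a) ≤ 1 := fun a hab =>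
      ⟨div_nonneg (by linarith) (by linarith), by rw [div_le_one (by linarith)]; linarith⟩
    have key : ∀ a, 0 ≤ a → a ≤ b →
        ((K - b) / (K - a)) ^ Module.finrank ℝ W * M a ≤ M b := fun a ha hab => by
      have := Convex.measure_fiberShift_ge μ hZ hc (a := a) hKne (hd a hab).1 (hd a hab).2
      have hne : K - a ≠ 0 := by linarith
      have e : (K - b) / (K - a) * a + (1 - (K - b) / (K - a)) * K = b := by
        field_simp; ring
      rw [e] at this
      simpa only [hMdef, max_eq_left ha, max_eq_left (ha.trans hab)] using this
    rcases le_total 0 a with ha | ha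
    · exact key a ha hab
    rcases le_total 0 b with hb | hb
    · refine le_trans ?_ (key 0 le_rfl hb)
      have : M a = M 0 := by simp [hMdef, max_eq_right ha]
      rw [this]
      refine mul_le_mul_of_nonneg_right (pow_le_pow_left₀ (hd a hab).1 ?_ _) (hnn 0)
      exact div_le_div_of_nonneg_left (by linarith) (by linarith) (by linarith)
    · have : M a = M b := by simp [hMdef, max_eq_right ha, max_eq_right hb]
      rw [this]
      exact mul_le_of_le_one_left (hnn _) (pow_le_one₀ (hd a hab).1 (hd a hab).2)
  · intro s hs
    simp [hMdef, max_eq_right hs]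
  · intro s hs
    simp [hMdef, max_eq_left (hK.trans hs.le), hKmax s hs]
  · intro k hk
    have hmeas : Measurable fun s => μ (fiberShift Z s) :=
      measurable_measure_prodMk_left (isCompact_fiberShift_graph hZ).measurableSet
    rw [hF k hk, measureReal_def, measure_diff_translate_eq_lintegral μ hZ hc hk,
      intervalIntegral.integral_of_le hk,
      ← integral_toReal hmeas.aemeasurable (.of_forall fun s => (hfin s).lt_top)]
    refine setIntegral_congr_fun measurableSet_Ioc fun s hs => ?_
    simp [hMdef, max_eq_left hs.1.le, measureReal_def]
  · intro k hk
    rw [hF k (hK.trans hk.le)]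
    congr 1
    ext ⟨t, p⟩
    simp only [mem_ofPred_eq, and_iff_left_iff_imp]
    intro h1 h2
    have : p ∈ fiberShift Z k := ⟨t - k, h2, by simpa using h1⟩
    rw [hKmax k hk] at this
    exact this

end Fiber

end

/-! ### The volume of a zonotope. -/

section

open MeasureTheory Set Filter Topology
open scoped ENNReal

section Zonotope

variable {E W W' : Type*} [Fintype E] [AddCommGroup W] [Module ℝ W] [AddCommGroup W'] [Module ℝ W']

/-- The zonotope `∑ e, [0, c e] • v e`. -/
def zonotope (v : E → W) (c : E → ℝ) : Set W :=
  (fun t : E → ℝ => ∑ e, t e • v e) '' Icc 0 c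

theorem image_zonotope (A : W →ₗ[ℝ] W') (v : E → W) (c : E → ℝ) :
    A '' zonotope v c = zonotope (A ∘ v) c := by
  simp [zonotope, image_image, map_sum]

theorem convex_zonotope (v : E → W) (c : E → ℝ) : Convex ℝ (zonotope v c) := by
  exact (convex_Icc (0 : E → ℝ) c).linear_image (Fintype.linearCombination ℝ v)

theorem zonotope_nonempty (v : E → W) {c : E → ℝ} (hc : 0 ≤ c) : (zonotope v c).Nonempty :=
  (nonempty_Icc.2 hc).image _

theorem isCompact_zonotope [TopologicalSpace W] [ContinuousAdd W] [ContinuousSMul ℝ W]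
    (v : E → W) (c : E → ℝ) : IsCompact (zonotope v c) :=
  isCompact_Icc.image (by fun_prop)

theorem zonotope_const_zero (v : E → W) : zonotope v 0 = {0} := by
  simp [zonotope]

/-- Separating the summand of `e`: the zonotope is the one with capacity `0` at `e`, swept along the
segment of `e`. -/
theorem mem_zonotope_iff_update [DecidableEq E] {v : E → W} {c : E → ℝ} (e : E)
    (p : W) : p ∈ zonotope v c ↔
      ∃ r ∈ Icc 0 (c e), p - r • v e ∈ zonotope v (Function.update c e 0) := by
  constructor
  · rintro ⟨t, ht, rfl⟩
    refine ⟨t e, ⟨ht.1 e, ht.2 e⟩, Function.update t e 0, ?_, ?_⟩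
    · constructor
      · intro a
        by_cases ha : a = e
        · subst ha; simp
        · simpa [ha] using ht.1 a
      · intro a
        by_cases ha : a = e
        · subst ha; simp
        · simpa [ha] using ht.2 a
    · simp only
      rw [← Finset.add_sum_erase _ (fun a => Function.update t e _ a • v a) (Finset.mem_univ e),
        ← Finset.add_sum_erase _ (fun a => t a • v a) (Finset.mem_univ e)]
      simp only [Function.update_self, zero_smul, zero_add, add_sub_cancel_left]
      refine Finset.sum_congr rfl fun a ha => ?_
      rw [Function.update_of_ne (Finset.ne_of_mem_erase ha)]
  · rintro ⟨r, hr, t, ht, h⟩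
    have hte : t e = 0 := le_antisymm (by simpa using ht.2 e) (ht.1 e)
    refine ⟨Function.update t e r, ?_, ?_⟩
    · constructor
      · intro a
        by_cases ha : a = e
        · subst ha; simpa using hr.1
        · simpa [ha] using ht.1 a
      · intro a
        by_cases ha : a = e
        · subst ha; simpa using hr.2
        · simpa [ha] using ht.2 a
    · simp only at h ⊢
      rw [eq_sub_iff_add_eq] at h
      rw [← h, ← Finset.add_sum_erase _ (fun a => Function.update t e _ a • v a) (Finset.mem_univ e),
        ← Finset.add_sum_erase _ (fun a => t a • v a) (Finset.mem_univ e)]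
      simp only [Function.update_self, hte, zero_smul, zero_add]
      rw [add_comm]
      congr 1
      refine Finset.sum_congr rfl fun a ha => ?_
      rw [Function.update_of_ne (Finset.ne_of_mem_erase ha)]

end Zonotope

section DetSum

variable {E : Type*}

theorem det_of_linearMap_comp {n : ℕ} (A : (Fin n → ℝ) →ₗ[ℝ] (Fin n → ℝ))
    (w : Fin n → Fin n → ℝ) :
    (Matrix.of fun i => A (w i)).det = LinearMap.det A * (Matrix.of w).det := by
  have := (Pi.basisFun ℝ (Fin n)).det_comp A w
  rwa [Pi.basisFun_det] at this

theorem det_of_eq_zero_of_not_injective {n : ℕ} (v : E → Fin n → ℝ) {f : Fin n → E}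
    (hf : ¬ Function.Injective f) : (Matrix.of fun i => v (f i)).det = 0 := by
  simp only [Function.Injective, not_forall] at hf
  obtain ⟨i, j, hij, hne⟩ := hf
  exact Matrix.det_zero_of_row_eq hne (by ext k; simp [hij])

/-- `n!` times the weighted sum of the absolute maximal minors of the vectors `v`. -/
noncomputable def detSum [Fintype E] {n : ℕ} (v : E → Fin n → ℝ) (c : E → ℝ) : ℝ :=
  ∑ f : Fin n → E, |(Matrix.of fun i => v (f i)).det| * ∏ i, c (f i)

theorem detSum_comp_linearMap [Fintype E] {n : ℕ} (A : (Fin n → ℝ) →ₗ[ℝ] (Fin n → ℝ))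
    (v : E → Fin n → ℝ) (c : E → ℝ) : detSum (A ∘ v) c = |LinearMap.det A| * detSum v c := by
  simp only [detSum, Function.comp_apply, det_of_linearMap_comp, abs_mul, Finset.mul_sum, mul_assoc]

theorem abs_det_of_insertNth {n : ℕ} (v : E → Fin (n + 1) → ℝ) {e : E} (he : v e = Pi.single 0 1)
    (i : Fin (n + 1)) (g : Fin n → E) :
    |(Matrix.of fun j => v (i.insertNth (α := fun _ => E) e g j)).det| =
      |(Matrix.of fun j => Fin.tail (v (g j))).det| := by
  rw [Matrix.det_succ_row _ i, Finset.sum_eq_single 0]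
  · rw [abs_mul, abs_mul, abs_pow]
    simp only [Matrix.of_apply, Fin.insertNth_apply_same, he, Pi.single_eq_same]
    simp only [abs_neg, abs_one, one_pow, one_mul]
    congr 2
    ext j k
    simp [Fin.tail]
  · intro j _ hj
    simp [he, hj]
  · simp

/-- Only injective tuples have nonzero determinant, and such a tuple takes the value `e` at most
once. Expansion along that row leaves the minor of the tails, and the factor `n + 1` counts the
possible positions of `e`. -/
theorem detSum_update [Fintype E] [DecidableEq E] {n : ℕ} (v : E → Fin (n + 1) → ℝ) (c : E → ℝ)
    {e : E} (he : v e = Pi.single 0 1) :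
    detSum v c = detSum v (Function.update c e 0) +
      (n + 1) * c e * detSum (fun a => Fin.tail (v a)) (Function.update c e 0) := by
  set c₀ := Function.update c e 0 with hc₀
  have hc₀e : c₀ e = 0 := by simp [hc₀]
  have hc₀ne : ∀ a, a ≠ e → c₀ a = c a := fun a ha => by simp [hc₀, ha]
  have key : ∀ f : Fin (n + 1) → E, |(Matrix.of fun i => v (f i)).det| * ∏ i, c (f i) =
      |(Matrix.of fun i => v (f i)).det| * ∏ i, c₀ (f i) +
        ∑ i, if f i = e then c e * (|(Matrix.of fun i => v (f i)).det| *
          ∏ j, c₀ (f (i.succAbove j))) else 0 := by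
    intro f
    by_cases hf : Function.Injective f
    swap
    · simp [det_of_eq_zero_of_not_injective v hf]
    by_cases h : ∃ i, f i = e
    · obtain ⟨i, hi⟩ := h
      have hne : ∀ j, j ≠ i → f j ≠ e := fun j hj h => hj (hf (h.trans hi.symm))
      rw [Finset.sum_eq_single i (fun j _ hj => if_neg (hne j hj)) (by simp), if_pos hi,
        Fin.prod_univ_succAbove (fun i => c (f i)) i, Fin.prod_univ_succAbove (fun i => c₀ (f i)) i,
        hi, hc₀e]
      have : ∏ j, c₀ (f (i.succAbove j)) = ∏ j, c (f (i.succAbove j)) :=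
        Finset.prod_congr rfl fun j _ => hc₀ne _ (hne _ (Fin.succAbove_ne i j))
      rw [this]; ring
    · push Not at h
      have : ∏ j, c₀ (f j) = ∏ j, c (f j) :=
        Finset.prod_congr rfl fun j _ => hc₀ne _ (h j)
      simp [h, this]
  rw [detSum, Finset.sum_congr rfl fun f _ => key f, Finset.sum_add_distrib]
  congr 1
  rw [Finset.sum_comm]
  have : ∀ i : Fin (n + 1), (∑ f : Fin (n + 1) → E, if f i = e then
      c e * (|(Matrix.of fun i => v (f i)).det| * ∏ j, c₀ (f (i.succAbove j))) else 0) =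
      c e * detSum (fun a => Fin.tail (v a)) c₀ := by
    intro i
    rw [← (Fin.insertNthEquiv (fun _ => E) i).sum_comp, Fintype.sum_prod_type,
      Finset.sum_eq_single e]
    · simp only [Fin.insertNthEquiv_apply, Fin.insertNth_apply_same, if_true,
        Fin.insertNth_apply_succAbove, abs_det_of_insertNth v he, detSum, Finset.mul_sum]
    · intro a _ ha
      simp [ha]
    · simp
  rw [Finset.sum_congr rfl fun i _ => this i]
  simp [mul_assoc]

end DetSum

/-- The linear equivalence that separates the first coordinate. -/
noncomputable def splitFirst (n : ℕ) : (Fin (n + 1) → ℝ) ≃ₗ[ℝ] ℝ × (Fin n → ℝ) :=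
  (Fin.consLinearEquiv ℝ (fun _ : Fin (n + 1) => ℝ)).symm

theorem volume_eq_prod_splitFirst {n : ℕ} (s : Set (Fin (n + 1) → ℝ)) :
    volume s = (volume.prod volume) (splitFirst n '' s) := by
  have hmp := (volume_preserving_piFinSuccAbove (fun _ : Fin (n + 1) => ℝ) 0).measure_preimage_equiv
    (splitFirst n '' s)
  refine Eq.trans ?_ hmp
  congr 1
  ext p
  exact (splitFirst n).injective.mem_set_image.symm

/-- Both sides obey the same recursion when a capacity is switched on: the gain is the capacity
times the quantity for the projection along that vector, one dimension lower. -/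
theorem factorial_mul_volume_zonotope {E : Type*} [Fintype E] (n : ℕ) (v : E → Fin n → ℝ)
    (c : E → ℝ) (hc : 0 ≤ c) : n.factorial * volume.real (zonotope v c) = detSum v c := by
  classical
  induction n generalizing c with
  | zero =>
    have : zonotope v c = univ := Subsingleton.eq_univ_of_nonempty (zonotope_nonempty v hc)
    rw [this]
    simp [detSum, measureReal_def, volume_pi]
  | succ n ih =>
    -- Inner induction on a finite set outside of which the capacities vanish.
    obtain ⟨s, hs⟩ : ∃ s : Finset E, ∀ e ∉ s, c e = 0 := ⟨Finset.univ, by simp⟩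
    induction s using Finset.induction_on generalizing v c with
    | empty =>
      have : c = 0 := funext fun e => hs e (by simp)
      subst this
      simp [zonotope_const_zero, detSum, measureReal_def]
    | insert e s hes ihs =>
      have hc₀ : 0 ≤ Function.update c e 0 := fun a => by
        by_cases h : a = e
        · subst h; simp
        · simpa [h] using hc a
      have hs₀ : ∀ a ∉ s, Function.update c e 0 a = 0 := fun a ha => by
        by_cases h : a = e
        · subst h; simp
        · simpa [h] using hs a (by simp [h, ha])
      -- The normalised case, in which the sweep is along the first axis and the shadow is the
      -- zonotope of the tails.
      have main : ∀ v : E → Fin (n + 1) → ℝ, v e = Pi.single 0 1 →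
          (n + 1).factorial * volume.real (zonotope v c) = detSum v c := by
        intro v he
        rw [detSum_update v c he, ← ihs v _ hc₀ hs₀, ← ih _ _ hc₀]
        set c₀ := Function.update c e 0 with hc₀def
        set φ := splitFirst n with hφ
        have hφapp : ∀ p, φ p = (p 0, Fin.tail p) := fun p => rfl
        have hvol : ∀ c', volume (zonotope v c') =
            (volume.prod volume) (zonotope (φ ∘ v) c') := fun c' => by
          rw [volume_eq_prod_splitFirst]
          exact congrArg _ (image_zonotope φ.toLinearMap v c')
        have hseg := measure_add_segment (volume : Measure (Fin n → ℝ))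
          (isCompact_zonotope (φ ∘ v) c₀) (convex_zonotope _ _) (hc e)
        have hφe : φ (v e) = (1, 0) := by
          rw [hφapp, he]
          ext i <;> simp [Fin.tail]
        have hset : zonotope (φ ∘ v) c =
            {z | ∃ r ∈ Icc 0 (c e), (z.1 - r, z.2) ∈ zonotope (φ ∘ v) c₀} := by
          ext z
          rw [mem_zonotope_iff_update e, mem_ofPred_eq]
          simp only [Function.comp_apply, hφe]
          refine exists_congr fun r => and_congr_right fun _ => ?_
          have : z - r • ((1 : ℝ), (0 : Fin n → ℝ)) = (z.1 - r, z.2) := by ext <;> simp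
          rw [this]
        have hsnd : Prod.snd '' zonotope (φ ∘ v) c₀ = zonotope (fun a => Fin.tail (v a)) c₀ := by
          exact image_zonotope (LinearMap.snd ℝ ℝ (Fin n → ℝ)) (φ ∘ v) c₀
        have hreal : volume.real (zonotope v c) = volume.real (zonotope v c₀) +
            c e * volume.real (zonotope (fun a => Fin.tail (v a)) c₀) := by
          simp only [measureReal_def]
          rw [hvol c, hset, hseg, ← hvol, hsnd, ENNReal.toReal_add, ENNReal.toReal_mul,
            ENNReal.toReal_ofReal (hc e)]
          · exact (isCompact_zonotope _ _).measure_lt_top.ne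
          · exact ENNReal.mul_ne_top ENNReal.ofReal_ne_top
              (isCompact_zonotope _ _).measure_lt_top.ne
        rw [hreal, Nat.factorial_succ]
        push_cast
        ring
      by_cases hve : v e = 0
      · have h1 : zonotope v c = zonotope v (Function.update c e 0) := by
          ext p
          rw [mem_zonotope_iff_update e]
          simp only [hve, smul_zero, sub_zero]
          exact ⟨fun ⟨_, _, h⟩ => h, fun h => ⟨0, ⟨le_rfl, hc e⟩, h⟩⟩
        have h2 : detSum v c = detSum v (Function.update c e 0) := by
          refine Finset.sum_congr rfl fun f _ => ?_
          by_cases h : ∃ i, f i = e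
          · obtain ⟨i, hi⟩ := h
            rw [Matrix.det_eq_zero_of_row_eq_zero i (by simp [hi, hve])]
            simp
          · push Not at h
            simp [h]
        rw [h1, h2]
        exact ihs v _ hc₀ hs₀
      -- A nonzero `v e` can be moved to the first unit vector by a linear automorphism, which
      -- multiplies both sides by the absolute value of its determinant.
      · obtain ⟨A, hA⟩ := SeparatingDual.exists_continuousLinearEquiv_apply_eq (R := ℝ) hve
          (show (Pi.single 0 1 : Fin (n + 1) → ℝ) ≠ 0 by simp)
        have h1 := main (A ∘ v) hA
        have hdet : LinearMap.det (A : (Fin (n + 1) → ℝ) →ₗ[ℝ] (Fin (n + 1) → ℝ)) ≠ 0 :=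
          A.toLinearEquiv.isUnit_det'.ne_zero
        have h2 := detSum_comp_linearMap (A : (Fin (n + 1) → ℝ) →ₗ[ℝ] (Fin (n + 1) → ℝ)) v c
        have h3 := image_zonotope (A : (Fin (n + 1) → ℝ) →ₗ[ℝ] (Fin (n + 1) → ℝ)) v c
        have h4 := Measure.addHaar_image_linearMap volume
          (A : (Fin (n + 1) → ℝ) →ₗ[ℝ] (Fin (n + 1) → ℝ)) (zonotope v c)
        rw [h3] at h4
        change detSum (A ∘ v) c = _ at h2
        change volume (zonotope (A ∘ v) c) = _ at h4
        rw [h2, measureReal_def, h4, ENNReal.toReal_mul, ENNReal.toReal_ofReal (abs_nonneg _),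
          mul_left_comm] at h1
        exact mul_left_cancel₀ (abs_ne_zero.2 hdet) h1

end

/-! ### Cauchy-Binet, unimodularity of incidence vectors and the matrix-tree theorem. -/

section

open MeasureTheory Set Filter Topology
open scoped ENNReal

section CauchyBinet

variable {E : Type*} [Fintype E]

theorem det_sum_vecMulVec_eq {n : ℕ} (v : E → Fin n → ℝ) (c : E → ℝ) :
    (Matrix.of fun i j => ∑ e, c e * (v e i * v e j)).det =
      ∑ f : Fin n → E, (∏ i, c (f i) * v (f i) i) * (Matrix.of fun i => v (f i)).det := by
  classical
  have h : (Matrix.of fun i j => ∑ e, c e * (v e i * v e j)).det =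
      Matrix.detRowAlternating (R := ℝ) fun i => ∑ e, (c e * v e i) • v e := by
    refine congrArg Matrix.det ?_
    ext i j
    simp [mul_assoc]
  rw [h]
  change (Matrix.detRowAlternating (R := ℝ)).toMultilinearMap _ = _
  rw [MultilinearMap.map_sum]
  refine Finset.sum_congr rfl fun f _ => ?_
  rw [MultilinearMap.map_smul_univ]
  rfl

/-- Reindexing the tuples in `det_sum_vecMulVec_eq` by a permutation `τ` changes the determinant by
its sign. Summing over all `τ` completes the product of entries to a second determinant. -/
theorem factorial_mul_det_sum_vecMulVec {n : ℕ} (v : E → Fin n → ℝ) (c : E → ℝ) :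
    n.factorial * (Matrix.of fun i j => ∑ e, c e * (v e i * v e j)).det =
      ∑ f : Fin n → E, (Matrix.of fun i => v (f i)).det ^ 2 * ∏ i, c (f i) := by
  classical
  have h : ∀ τ : Equiv.Perm (Fin n), (Matrix.of fun i j => ∑ e, c e * (v e i * v e j)).det =
      ∑ f : Fin n → E, (∏ i, c (f i)) * (Matrix.of fun i => v (f i)).det *
        (Equiv.Perm.sign τ * ∏ i, v (f (τ i)) i) := by
    intro τ
    rw [det_sum_vecMulVec_eq, ← (Equiv.arrowCongr τ (Equiv.refl E)).symm.sum_comp]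
    refine Finset.sum_congr rfl fun f _ => ?_
    have h1 : (Equiv.arrowCongr τ (Equiv.refl E)).symm f = fun i => f (τ i) := rfl
    rw [h1, Finset.prod_mul_distrib, Equiv.prod_comp τ fun i => c (f i)]
    have h2 := Matrix.det_permute τ (Matrix.of fun i => v (f i))
    have h3 : (Matrix.of fun i => v (f i)).submatrix τ id = Matrix.of fun i => v (f (τ i)) := rfl
    rw [h3] at h2
    rw [h2]
    ring
  have h4 : (n.factorial : ℝ) * (Matrix.of fun i j => ∑ e, c e * (v e i * v e j)).det =
      ∑ _τ : Equiv.Perm (Fin n), (Matrix.of fun i j => ∑ e, c e * (v e i * v e j)).det := by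
    simp [Fintype.card_perm]
  rw [h4, Finset.sum_congr rfl fun τ _ => h τ, Finset.sum_comm]
  refine Finset.sum_congr rfl fun f _ => ?_
  rw [← Finset.mul_sum, sq]
  have h5 : (Matrix.of fun i => v (f i)).det =
      ∑ τ : Equiv.Perm (Fin n), (Equiv.Perm.sign τ * ∏ i, v (f (τ i)) i : ℝ) :=
    Matrix.det_apply' _
  rw [← h5]
  ring

end CauchyBinet

namespace CreditNetwork.MGraph

variable {V E : Type*} {G : MGraph V E}

theorem Walk.exists_append {u v w : V} (p : G.Walk u v) (q : G.Walk v w) :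
    ∃ s : G.Walk u w, s.edges = p.edges ++ q.edges ∧
      ∀ {n : ℕ} (D : E → Fin n → ℝ), s.direction D = p.direction D + q.direction D := by
  induction p with
  | nil u => exact ⟨q, rfl, fun D => (zero_add _).symm⟩
  | fwd e p ih =>
    obtain ⟨s, h1, h2⟩ := ih q
    exact ⟨.fwd e s, by simp [Walk.edges, h1], fun D => by simp [Walk.direction, h2, add_assoc]⟩
  | bwd e p ih =>
    obtain ⟨s, h1, h2⟩ := ih q
    exact ⟨.bwd e s, by simp [Walk.edges, h1], fun D => by simp [Walk.direction, h2, add_assoc]⟩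

open Classical in
/-- The indicator vector of a vertex in the coordinates `σ`. -/
noncomputable def vertexVec (R : Type*) [Ring R] {n : ℕ} (σ : Fin n → V) (v : V) : Fin n → R :=
  fun i => if v = σ i then 1 else 0

/-- The incidence vector of an edge in the coordinates `σ`. -/
noncomputable def incidence (R : Type*) [Ring R] {n : ℕ} (G : MGraph V E) (σ : Fin n → V) (e : E) :
    Fin n → R :=
  vertexVec R σ (G.tgt e) - vertexVec R σ (G.src e)

/-- The coefficients count signed traversals. That they are integers is what makes the minors units.
-/
theorem Walk.exists_sum_incidence {n m : ℕ} (σ : Fin n → V) (f : Fin m → E) {u v : V}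
    (p : G.Walk u v) (hp : ∀ e ∈ p.edges, e ∈ Set.range f) :
    ∃ a : Fin m → ℤ, ∑ j, a j • G.incidence ℤ σ (f j) = vertexVec ℤ σ v - vertexVec ℤ σ u := by
  classical
  induction p with
  | nil u => exact ⟨0, by simp⟩
  | fwd e p ih =>
    obtain ⟨a, ha⟩ := ih fun e he => hp e (by simp [Walk.edges, he])
    obtain ⟨j, hj⟩ := hp e (by simp [Walk.edges])
    refine ⟨a + Pi.single j 1, ?_⟩
    simp only [Pi.add_apply, add_smul, Finset.sum_add_distrib, ha]
    rw [Finset.sum_eq_single j (fun i _ hi => by simp [hi]) (by simp)]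
    simp [hj, incidence]
  | bwd e p ih =>
    obtain ⟨a, ha⟩ := ih fun e he => hp e (by simp [Walk.edges, he])
    obtain ⟨j, hj⟩ := hp e (by simp [Walk.edges])
    refine ⟨a - Pi.single j 1, ?_⟩
    simp only [Pi.sub_apply, sub_smul, Finset.sum_sub_distrib, ha]
    rw [Finset.sum_eq_single (f := fun x => (Pi.single j 1 : Fin m → ℤ) x • _) j
      (fun i _ hi => by simp [hi]) (by simp)]
    simp [hj, incidence]

/-- `σ` enumerates the vertices other than `r`. -/
structure IsEnumeration {n : ℕ} (σ : Fin n → V) (r : V) : Prop where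
  injective : Function.Injective σ
  mem_range_iff : ∀ v, v ∈ Set.range σ ↔ v ≠ r

variable {n : ℕ} {σ : Fin n → V} {r : V}

theorem IsEnumeration.card_eq (hσ : IsEnumeration σ r) : Nat.card V = n + 1 := by
  classical
  have e : Option (Fin n) ≃ V := Equiv.ofBijective (fun o => o.elim r σ) (by
    constructor
    · rintro (_ | i) (_ | j) h
      · rfl
      · exact absurd h.symm ((hσ.mem_range_iff _).1 ⟨j, rfl⟩)
      · exact absurd h ((hσ.mem_range_iff _).1 ⟨i, rfl⟩)
      · exact congrArg some (hσ.injective h)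
    · intro v
      by_cases hv : v = r
      · exact ⟨none, hv.symm⟩
      · obtain ⟨i, hi⟩ := (hσ.mem_range_iff v).2 hv
        exact ⟨some i, hi⟩)
  rw [← Nat.card_congr e]
  simp

theorem vertexVec_root (hσ : IsEnumeration σ r) (R : Type*) [Ring R] : vertexVec R σ r = 0 := by
  funext i
  have : r ≠ σ i := fun h => (hσ.mem_range_iff r).1 ⟨i, h.symm⟩ rfl
  simp [vertexVec, this]

theorem vertexVec_apply_enum (hσ : IsEnumeration σ r) (R : Type*) [Ring R] (i : Fin n) :
    vertexVec R σ (σ i) = Pi.single i 1 := by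
  funext j
  by_cases h : i = j
  · subst h; simp [vertexVec]
  · have : σ i ≠ σ j := fun h' => h (hσ.injective h')
    simp [vertexVec, this, Ne.symm h]

/-- Walks from the root to the other vertices express the unit vectors as integer combinations of
the rows. So the matrix is invertible over `ℤ`. -/
theorem abs_det_incidence_of_connectedBy (hσ : IsEnumeration σ r) [DecidableEq E] {f : Fin n → E}
    (hf : G.ConnectedBy (Finset.univ.image f)) :
    |(Matrix.of fun i => G.incidence ℤ σ (f i)).det| = 1 := by
  have h : ∀ i, ∃ a : Fin n → ℤ, ∑ j, a j • G.incidence ℤ σ (f j) = Pi.single i 1 := by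
    intro i
    obtain ⟨p, hp⟩ := hf r (σ i)
    obtain ⟨a, ha⟩ := p.exists_sum_incidence σ f fun e he => by simpa using hp e he
    exact ⟨a, by rw [ha, vertexVec_root hσ, sub_zero, vertexVec_apply_enum hσ]⟩
  choose a ha using h
  have h1 : Matrix.of a * (Matrix.of fun i => G.incidence ℤ σ (f i)) = 1 := by
    ext i k
    have := congrFun (ha i) k
    simp only [Finset.sum_apply, Pi.smul_apply, smul_eq_mul] at this
    simp only [Matrix.mul_apply, Matrix.of_apply, this, Matrix.one_apply, Pi.single_apply, eq_comm]
  have h2 := congrArg Matrix.det h1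
  rw [Matrix.det_mul, Matrix.det_one, mul_comm] at h2
  exact Int.isUnit_iff_abs_eq.1 (IsUnit.of_mul_eq_one _ h2)

/-- The indicator of the component of `u`, shifted to vanish at the root, is constant along all
edges used and not identically zero. It is therefore a kernel vector. -/
theorem det_incidence_of_not_connectedBy (hσ : IsEnumeration σ r) [DecidableEq E] {f : Fin n → E}
    (hf : ¬ G.ConnectedBy (Finset.univ.image f)) :
    (Matrix.of fun i => G.incidence ℤ σ (f i)).det = 0 := by
  classical
  simp only [ConnectedBy, not_forall] at hf
  obtain ⟨u, v, huv⟩ := hf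
  let C : V → ℤ := fun w =>
    if ∃ p : G.Walk u w, ∀ e ∈ p.edges, e ∈ Finset.univ.image f then 1 else 0
  have hCu : C u = 1 := if_pos ⟨.nil u, by simp [Walk.edges]⟩
  have hCv : C v = 0 := if_neg huv
  have hC : ∀ i, C (G.src (f i)) = C (G.tgt (f i)) := by
    intro i
    have hi : f i ∈ Finset.univ.image f := by simp
    have : (∃ p : G.Walk u (G.src (f i)), ∀ e ∈ p.edges, e ∈ Finset.univ.image f) ↔
        ∃ p : G.Walk u (G.tgt (f i)), ∀ e ∈ p.edges, e ∈ Finset.univ.image f := by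
      constructor
      · rintro ⟨p, hp⟩
        obtain ⟨s, hs, -⟩ := p.exists_append (.fwd (f i) (.nil _))
        refine ⟨s, fun e he => ?_⟩
        rw [hs, List.mem_append] at he
        rcases he with he | he
        · exact hp e he
        · simp only [Walk.edges, List.mem_singleton] at he
          exact he ▸ hi
      · rintro ⟨p, hp⟩
        obtain ⟨s, hs, -⟩ := p.exists_append (.bwd (f i) (.nil _))
        refine ⟨s, fun e he => ?_⟩
        rw [hs, List.mem_append] at he
        rcases he with he | he
        · exact hp e he
        · simp only [Walk.edges, List.mem_singleton] at he
          exact he ▸ hi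
    simp only [C, this]
  have hdot : ∀ w, ∑ j, vertexVec ℤ σ w j * (C (σ j) - C r) = C w - C r := by
    intro w
    by_cases hw : w = r
    · subst hw
      simp [vertexVec_root hσ]
    · obtain ⟨i, rfl⟩ := (hσ.mem_range_iff w).2 hw
      rw [vertexVec_apply_enum hσ, Finset.sum_eq_single i (fun j _ hj => by simp [hj]) (by simp)]
      simp
  refine Matrix.exists_mulVec_eq_zero_iff.1 ⟨fun j => C (σ j) - C r, fun h0 => ?_, ?_⟩
  · have hall : ∀ w, C w = C r := by
      intro w
      by_cases hw : w = r
      · rw [hw]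
      · obtain ⟨i, rfl⟩ := (hσ.mem_range_iff w).2 hw
        exact sub_eq_zero.1 (congrFun h0 i)
    have := (hall u).trans (hall v).symm
    rw [hCu, hCv] at this
    exact one_ne_zero this
  · funext i
    simp only [Matrix.mulVec, dotProduct, Matrix.of_apply, incidence, Pi.sub_apply, sub_mul,
      Finset.sum_sub_distrib, hdot, hC, Pi.zero_apply]
    ring

theorem det_incidence_intCast (σ : Fin n → V) (f : Fin n → E) :
    (Matrix.of fun i => G.incidence ℝ σ (f i)).det =
      ((Matrix.of fun i => G.incidence ℤ σ (f i)).det : ℝ) := by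
  rw [Int.cast_det]
  congr 1
  ext i j
  simp [incidence, vertexVec]

open Classical in
theorem abs_det_incidence (hσ : IsEnumeration σ r) (f : Fin n → E) :
    |(Matrix.of fun i => G.incidence ℝ σ (f i)).det| =
      if G.IsSpanningTree (Finset.univ.image f) then 1 else 0 := by
  rw [det_incidence_intCast, ← Int.cast_abs]
  split_ifs with h
  · rw [abs_det_incidence_of_connectedBy hσ h.1, Int.cast_one]
  · by_cases hc : G.ConnectedBy (Finset.univ.image f)
    · exfalso
      -- A connecting image has a nonzero minor, so `f` has no repetition and the image has `n`
      -- elements: it would be a spanning tree after all.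
      have h1 := abs_det_incidence_of_connectedBy hσ hc
      have hinj : Function.Injective f := by
        by_contra hinj
        simp only [Function.Injective, not_forall] at hinj
        obtain ⟨i, j, hij, hne⟩ := hinj
        rw [Matrix.det_zero_of_row_eq hne (by ext k; simp [hij])] at h1
        simp at h1
      exact h ⟨hc, by rw [Finset.card_image_of_injective _ hinj, hσ.card_eq]; simp⟩
    · rw [det_incidence_of_not_connectedBy hσ hc]
      simp

theorem card_filter_image_eq [Fintype E] [DecidableEq E] {T : Finset E} (hT : T.card = n) :
    (Finset.univ.filter fun f : Fin n → E => Finset.univ.image f = T).card = n.factorial := by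
  have e : {f : Fin n → E // Finset.univ.image f = T} ≃ (Fin n ≃ T) :=
    { toFun := fun f => Equiv.ofBijective (fun i => ⟨f.1 i, f.2.subset (by simp)⟩) (by
        rw [Fintype.bijective_iff_surjective_and_card]
        refine ⟨fun ⟨a, ha⟩ => ?_, by simp [hT]⟩
        rw [← f.2] at ha
        obtain ⟨i, -, hi⟩ := Finset.mem_image.1 ha
        exact ⟨i, Subtype.ext hi⟩)
      invFun := fun g => ⟨fun i => g i, by
        ext a
        simp only [Finset.mem_image, Finset.mem_univ, true_and]
        constructor
        · rintro ⟨i, rfl⟩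
          exact (g i).2
        · exact fun ha => ⟨g.symm ⟨a, ha⟩, by simp⟩⟩
      left_inv := fun f => rfl
      right_inv := fun g => by ext; rfl }
  rw [← Fintype.card_subtype, Fintype.card_congr e,
    Fintype.card_equiv (Fintype.equivOfCardEq (by simp [hT]))]
  simp

/-- Tuples are grouped by their image; each spanning tree arises from `n!` orderings. -/
theorem sum_abs_det_incidence [Fintype E] (hσ : IsEnumeration σ r) (c : E → ℝ) :
    detSum (G.incidence ℝ σ) c = n.factorial * G.treeGen c := by
  classical
  simp only [detSum, abs_det_incidence hσ, treeGen]
  rw [← Finset.sum_fiberwise Finset.univ (fun f : Fin n → E => Finset.univ.image f),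
    Finset.sum_filter, Finset.mul_sum]
  refine Finset.sum_congr rfl fun T _ => ?_
  split_ifs with hT
  · have hcard : T.card = n := by
      have := hT.2
      rw [hσ.card_eq] at this
      omega
    rw [← card_filter_image_eq hcard, ← nsmul_eq_mul, ← Finset.sum_const]
    refine Finset.sum_congr rfl fun f hf => ?_
    have hf : Finset.univ.image f = T := (Finset.mem_filter.1 hf).2
    subst hf
    have hinj : Function.Injective f := by
      rw [← Set.injOn_univ, ← Finset.coe_univ, ← Finset.card_image_iff, hcard]
      simp
    rw [if_pos hT, one_mul, Finset.prod_image fun i _ j _ h => hinj h]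
  · rw [mul_zero]
    refine Finset.sum_eq_zero fun f hf => ?_
    rw [(Finset.mem_filter.1 hf).2, if_neg hT, zero_mul]

/-- The volume of the zonotope of the reduced incidence vectors. -/
theorem volume_zonotope_incidence [Fintype E] (hσ : IsEnumeration σ r) {c : E → ℝ} (hc : 0 ≤ c) :
    volume.real (zonotope (G.incidence ℝ σ) c) = G.treeGen c := by
  have h1 := factorial_mul_volume_zonotope n (G.incidence ℝ σ) c hc
  rw [sum_abs_det_incidence hσ] at h1
  exact mul_left_cancel₀ (by positivity) h1

/-- The matrix-tree theorem. -/
theorem det_laplacian_eq_treeGen [Fintype E] (hσ : IsEnumeration σ r) (c : E → ℝ) :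
    (Matrix.of fun i j => ∑ e, c e * (G.incidence ℝ σ e i * G.incidence ℝ σ e j)).det =
      G.treeGen c := by
  have h1 := factorial_mul_det_sum_vecMulVec (G.incidence ℝ σ) c
  have h2 : ∑ f : Fin n → E, (Matrix.of fun i => G.incidence ℝ σ (f i)).det ^ 2 * ∏ i, c (f i) =
      detSum (G.incidence ℝ σ) c := by
    classical
    refine Finset.sum_congr rfl fun f _ => ?_
    rw [← sq_abs, abs_det_incidence hσ]
    split_ifs <;> simp
  rw [h2, sum_abs_det_incidence hσ] at h1
  exact mul_left_cancel₀ (by positivity) h1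

/-- The retraction that sends `y` to `x` descends to the quotient and separates its points. -/
theorem identify_mk_eq_iff {x y u v : V} :
    (Quot.mk (fun u v : V => u = x ∧ v = y) u = Quot.mk _ v) ↔
      u = v ∨ ((u = x ∨ u = y) ∧ (v = x ∨ v = y)) := by
  classical
  constructor
  · intro h
    have h1 := congrArg (Quot.lift (fun w : V => if w = y then x else w)
      (by rintro _ _ ⟨rfl, rfl⟩; simp)) h
    simp only at h1
    split_ifs at h1 <;> simp_all
  · have hxy : (Quot.mk (fun u v : V => u = x ∧ v = y) x) = Quot.mk _ y := Quot.sound ⟨rfl, rfl⟩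
    rintro (rfl | ⟨rfl | rfl, rfl | rfl⟩) <;> simp [hxy]

theorem IsEnumeration.identify {x y : V} {σ : Fin (n + 1) → V} (hσ : IsEnumeration σ x)
    (h0 : σ 0 = y) : IsEnumeration
      (fun i : Fin n => Quot.mk (fun u v : V => u = x ∧ v = y) (σ i.succ)) (Quot.mk _ x) := by
  have hx : ∀ i, σ i ≠ x := fun i => (hσ.mem_range_iff _).1 ⟨i, rfl⟩
  have hy : ∀ i : Fin n, σ i.succ ≠ y := fun i h =>
    Fin.succ_ne_zero i (hσ.injective (h.trans h0.symm))
  constructor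
  · intro i j h
    rw [identify_mk_eq_iff] at h
    rcases h with h | h
    · exact Fin.succ_injective _ (hσ.injective h)
    · exact absurd h.1 (by simp [hx, hy])
  · intro q
    induction q using Quot.ind with
    | mk v =>
      simp only [mem_range, ne_eq, identify_mk_eq_iff]
      constructor
      · rintro ⟨i, h | h⟩
        · subst h
          simp [hx, hy]
        · exact absurd h.1 (by simp [hx, hy])
      · intro h
        have hvx : v ≠ x := fun h' => h (Or.inl h')
        have hvy : v ≠ y := fun h' => h (by simp [h'])
        obtain ⟨i, rfl⟩ := (hσ.mem_range_iff v).2 hvx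
        obtain ⟨j, rfl⟩ := Fin.exists_succ_eq.2 (fun hi : i = 0 => hvy (hi ▸ h0))
        exact ⟨j, Or.inl rfl⟩

/-- The root `x` has no coordinate, so merging `y` into it deletes the coordinate `0`, which belongs
to `y`. -/
theorem incidence_identify {x y : V} {σ : Fin (n + 1) → V} (hσ : IsEnumeration σ x)
    (h0 : σ 0 = y) (e : E) :
    (G.identify x y).incidence ℝ (fun i : Fin n => Quot.mk _ (σ i.succ)) e =
      Fin.tail (G.incidence ℝ σ e) := by
  have hx : ∀ i, σ i ≠ x := fun i => (hσ.mem_range_iff _).1 ⟨i, rfl⟩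
  have hy : ∀ i : Fin n, σ i.succ ≠ y := fun i h =>
    Fin.succ_ne_zero i (hσ.injective (h.trans h0.symm))
  have h : ∀ v i, (Quot.mk (fun u v : V => u = x ∧ v = y) v = Quot.mk _ (σ (Fin.succ i))) =
      (v = σ i.succ) := fun v i => by
    rw [identify_mk_eq_iff]
    simp [hx, hy]
  have h' : ∀ v i, vertexVec ℝ (fun i : Fin n => Quot.mk (fun u v : V => u = x ∧ v = y) (σ i.succ))
      (Quot.mk _ v) i = vertexVec ℝ σ v i.succ := fun v i => by
    unfold vertexVec
    congr 1
    exact h v i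
  funext i
  exact congrArg₂ (fun a b : ℝ => a - b) (h' _ i) (h' _ i)

theorem exists_isEnumeration [Fintype V] (hn : Fintype.card V = n + 2) {x y : V} (hxy : x ≠ y) :
    ∃ σ : Fin (n + 1) → V, IsEnumeration σ x ∧ σ 0 = y := by
  classical
  have e : Fin (n + 1) ≃ {v : V // v ≠ x} :=
    (Fintype.equivFinOfCardEq (by simp [Fintype.card_subtype_compl, hn])).symm
  -- The swap puts `y` at index `0`.
  let e' := (Equiv.swap 0 (e.symm ⟨y, hxy.symm⟩)).trans e
  refine ⟨fun i => e' i, ⟨fun i j h => e'.injective (Subtype.ext h), fun v => ?_⟩, by simp [e']⟩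
  constructor
  · rintro ⟨i, rfl⟩
    exact (e' i).2
  · exact fun hv => ⟨e'.symm ⟨v, hv⟩, by simp⟩

end CreditNetwork.MGraph

end

/-! ### From the payment network to the zonotope. -/

section

open MeasureTheory Set Filter Topology
open scoped ENNReal

namespace CreditNetwork

open MGraph

variable {V E : Type*} {G : MGraph V E}

theorem MGraph.exists_isSpanningTree_of_treeGen_pos [Fintype E] {c : E → ℝ}
    (h : 0 < G.treeGen c) : ∃ T, G.IsSpanningTree T := by
  classical
  by_contra! hT
  rw [treeGen, Finset.filter_false_of_mem fun T _ => hT T] at h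
  simp at h

/-- A spanning representation is the image of the reduced incidence vectors under a linear
equivalence. -/
theorem MGraph.IsSpanningRepresentation.exists_linearEquiv [Fintype E] {n : ℕ} {σ : Fin n → V}
    {x : V} (hσ : IsEnumeration σ x) {D : E → Fin n → ℝ} (hD : G.IsSpanningRepresentation D)
    {T : Finset E} (hT : G.IsSpanningTree T) :
    ∃ B : (Fin n → ℝ) ≃ₗ[ℝ] (Fin n → ℝ), D = B ∘ G.incidence ℝ σ := by
  choose p hp using fun v => hT.1 x v
  let φ : V → Fin n → ℝ := fun v => (p v).direction D
  have hφ : ∀ e, D e = φ (G.tgt e) - φ (G.src e) := by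
    intro e
    -- `D` is the difference of a potential: two walks to the target of `e`, one through `e`, are
    -- closed by the same return walk, and both closed walks have direction `0`.
    obtain ⟨q, -, hq⟩ := (p (G.src e)).exists_append (.fwd e (.nil _))
    obtain ⟨z, -, hz⟩ := (hT.1 (G.tgt e) x).choose.exists_append (p (G.tgt e))
    obtain ⟨z', -, hz'⟩ := (hT.1 (G.tgt e) x).choose.exists_append q
    have h1 := (hD.direction_eq_zero_iff _ _ z).2 rfl
    have h2 := (hD.direction_eq_zero_iff _ _ z').2 rfl
    rw [hz] at h1
    rw [hz', hq] at h2
    have h3 := add_left_cancel (h1.trans h2.symm)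
    simp only [Walk.direction, add_zero] at h3
    change φ (G.tgt e) = φ (G.src e) + D e at h3
    rw [h3, add_sub_cancel_left]
  have hφx : φ x = 0 := (hD.direction_eq_zero_iff _ _ (p x)).2 rfl
  let B : (Fin n → ℝ) →ₗ[ℝ] (Fin n → ℝ) := Fintype.linearCombination ℝ fun i => φ (σ i)
  have hBv : ∀ v, B (vertexVec ℝ σ v) = φ v := by
    intro v
    by_cases hv : v = x
    · rw [hv, vertexVec_root hσ, map_zero, hφx]
    · obtain ⟨i, rfl⟩ := (hσ.mem_range_iff v).2 hv
      rw [vertexVec_apply_enum hσ]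
      simp [B]
  have hB : ∀ e, B (G.incidence ℝ σ e) = D e := fun e => by
    rw [incidence, map_sub, hBv, hBv, hφ]
  -- The span condition makes `B` onto, hence bijective for reasons of dimension.
  have hsurj : Function.Surjective B := by
    rw [← LinearMap.range_eq_top, eq_top_iff, ← hD.span_eq_top T hT, Submodule.span_le]
    rintro _ ⟨e, -, rfl⟩
    exact ⟨_, hB e⟩
  refine ⟨LinearEquiv.ofBijective B ⟨LinearMap.injective_iff_surjective.2 hsurj, hsurj⟩, ?_⟩
  funext e
  exact (hB e).symm

theorem score_eq_image [Fintype E] {n : ℕ} {D b : E → Fin n → ℝ}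
    {B : (Fin n → ℝ) ≃ₗ[ℝ] (Fin n → ℝ)} (hB : D = B ∘ b) (w : Escrow E) :
    score D w = B (score b w) := by
  subst hB
  simp [score, map_sum]

theorem score_image_configurations [Fintype E] {n : ℕ} (b : E → Fin n → ℝ) (c : E → ℝ)
    (P : (Fin n → ℝ) → Prop) :
    score b '' {w ∈ configurations c | P (score b w)} = {z | z ∈ zonotope b c ∧ P z} := by
  ext z
  constructor
  · rintro ⟨w, ⟨hw, hP⟩, rfl⟩
    refine ⟨⟨w.atSrc, ⟨fun e => (hw e).1, fun e => ?_⟩, rfl⟩, hP⟩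
    have := hw e
    linarith
  · rintro ⟨⟨t, ht, rfl⟩, hP⟩
    exact ⟨⟨t, fun e => c e - t e⟩,
      ⟨fun e => ⟨ht.1 e, sub_nonneg.2 (ht.2 e), by ring⟩, hP⟩, rfl⟩

-- Flow conservation at the root `x` needs no equation of its own: both sides of the balance sum to
-- `0` over all vertices.
open Classical in
theorem flow_iff_sum_incidence [Fintype V] [Fintype E] {n : ℕ} {σ : Fin (n + 1) → V} {x y : V}
    (hσ : IsEnumeration σ x) (h0 : σ 0 = y) (fwd bwd : E → ℝ) (k : ℝ) :
    (∀ z : V,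
      (∑ e, ((if G.src e = z then fwd e else 0) + (if G.tgt e = z then bwd e else 0))) -
        (∑ e, ((if G.tgt e = z then fwd e else 0) + (if G.src e = z then bwd e else 0))) =
      (if z = x then k else 0) - (if z = y then k else 0)) ↔
    ∑ e, (fwd e - bwd e) • G.incidence ℝ σ e = k • Pi.single 0 1 := by
  set h : V → ℝ := fun z =>
    (∑ e, ((if G.src e = z then fwd e else 0) + (if G.tgt e = z then bwd e else 0))) -
        (∑ e, ((if G.tgt e = z then fwd e else 0) + (if G.src e = z then bwd e else 0))) with hh
  set g : V → ℝ := fun z => (if z = x then k else 0) - (if z = y then k else 0) with hg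
  have h1 : ∀ i, (∑ e, (fwd e - bwd e) • G.incidence ℝ σ e) i = - h (σ i) := by
    intro i
    simp only [hh, Finset.sum_apply, Pi.smul_apply, smul_eq_mul, incidence, vertexVec,
      Pi.sub_apply, ← Finset.sum_sub_distrib, ← Finset.sum_neg_distrib]
    refine Finset.sum_congr rfl fun e _ => ?_
    split_ifs <;> ring
  have hx : ∀ i, σ i ≠ x := fun i => (hσ.mem_range_iff _).1 ⟨i, rfl⟩
  have h2 : ∀ i, (k • Pi.single 0 1 : Fin (n + 1) → ℝ) i = - g (σ i) := by
    intro i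
    by_cases hi : i = 0
    · subst hi
      simp [hg, h0, (h0 ▸ hx 0 : y ≠ x)]
    · have : σ i ≠ y := fun h => hi (hσ.injective (h.trans h0.symm))
      simp [hg, hx, this, hi]
  have h3 : ∑ z, h z = 0 := by
    simp only [hh, Finset.sum_sub_distrib]
    rw [Finset.sum_comm, Finset.sum_comm (s := Finset.univ (α := V)) (t := Finset.univ (α := E))]
    simp [Finset.sum_add_distrib]
  have h4 : ∑ z, g z = 0 := by simp [hg]
  constructor
  · intro H
    funext i
    rw [h1, h2]
    exact congrArg _ (H (σ i))
  · intro H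
    have H' : ∀ z, z ≠ x → h z = g z := by
      intro z hz
      obtain ⟨i, rfl⟩ := (hσ.mem_range_iff z).2 hz
      have := congrFun H i
      rw [h1, h2] at this
      exact neg_injective this
    intro z
    by_cases hz : z = x
    · subst hz
      rw [← Finset.add_sum_erase _ _ (Finset.mem_univ z)] at h3 h4
      rw [Finset.sum_congr rfl fun w hw => H' w (Finset.ne_of_mem_erase hw)] at h3
      exact add_right_cancel (h3.trans h4.symm)
    · exact H' z hz

/-- Executing a flow gives another configuration, whose score is shifted. Conversely, the difference
between `w` and any configuration with the shifted score is a feasible flow. -/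
theorem succeeds_iff [Fintype V] [Fintype E] {n : ℕ} {σ : Fin (n + 1) → V} {x y : V}
    (hσ : IsEnumeration σ x) (h0 : σ 0 = y) {c : E → ℝ} {w : Escrow E}
    (hw : w ∈ configurations c) (k : ℝ) :
    Succeeds G x y k w ↔
      score (G.incidence ℝ σ) w - k • Pi.single 0 1 ∈ zonotope (G.incidence ℝ σ) c := by
  simp only [Succeeds, flow_iff_sum_incidence hσ h0]
  constructor
  · rintro ⟨fwd, bwd, hb, h⟩
    refine ⟨fun e => w.atSrc e - (fwd e - bwd e), ⟨fun e => ?_, fun e => ?_⟩, ?_⟩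
    · have := hb e
      simp only [Pi.zero_apply]
      linarith
    · have := hb e
      have := hw e
      simp only
      linarith
    · rw [← h, score, ← Finset.sum_sub_distrib]
      exact Finset.sum_congr rfl fun e _ => sub_smul _ _ _
  · rintro ⟨t, ht, h⟩
    -- The positive and negative parts of the change on each edge are sent in the two directions.
    refine ⟨fun e => max (w.atSrc e - t e) 0, fun e => max (t e - w.atSrc e) 0, fun e => ?_, ?_⟩
    · have h1 := hw e
      have h2 := ht.1 e
      have h3 := ht.2 e
      simp only [Pi.zero_apply] at h2
      refine ⟨le_max_right _ _, max_le ?_ ?_, le_max_right _ _, max_le ?_ ?_⟩ <;> linarith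
    · simp only at h
      rw [eq_sub_iff_add_eq, ← eq_sub_iff_add_eq'] at h
      rw [h, score, ← Finset.sum_sub_distrib]
      refine Finset.sum_congr rfl fun e _ => ?_
      rw [← sub_smul]
      congr 1
      simp only
      rcases le_total (w.atSrc e) (t e) with h' | h'
      · rw [max_eq_right (by linarith), max_eq_left (by linarith)]; ring
      · rw [max_eq_left (by linarith), max_eq_right (by linarith)]; ring

/-- Numerator and denominator scale by the same determinant, so the choice of representation does
not matter. -/
theorem prob_eq [Fintype E] {n : ℕ} {D b : E → Fin n → ℝ}
    {B : (Fin n → ℝ) ≃ₗ[ℝ] (Fin n → ℝ)} (hB : D = B ∘ b) (c : E → ℝ) (A : Set (Escrow E)) :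
    prob D c A = volume.real (score b '' A) / volume.real (zonotope b c) := by
  have h1 : ∀ A : Set (Escrow E), volume.real (score D '' A) =
      |LinearMap.det (B : (Fin n → ℝ) →ₗ[ℝ] (Fin n → ℝ))| * volume.real (score b '' A) := by
    intro A
    have h2 : score D '' A = (B : (Fin n → ℝ) →ₗ[ℝ] (Fin n → ℝ)) '' (score b '' A) := by
      rw [image_image]
      exact image_congr fun w _ => score_eq_image hB w
    rw [h2, measureReal_def, Measure.addHaar_image_linearMap, ENNReal.toReal_mul,
      ENNReal.toReal_ofReal (abs_nonneg _), measureReal_def]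
  have h3 : score b '' configurations c = zonotope b c := by
    simpa using score_image_configurations b c fun _ => True
  have hdet : LinearMap.det (B : (Fin n → ℝ) →ₗ[ℝ] (Fin n → ℝ)) ≠ 0 := B.isUnit_det'.ne_zero
  rw [prob, h1, h1, h3, mul_div_mul_left _ _ (abs_ne_zero.2 hdet)]

theorem failProb_properties [Fintype V] [Fintype E] {n : ℕ} (hn : Fintype.card V = n + 1)
    {c : E → ℝ} (hc : ∀ e, 0 ≤ c e) (hpos : 0 < G.treeGen c)
    {D : E → Fin n → ℝ} (hD : G.IsSpanningRepresentation D) {x y : V} (hxy : x ≠ y) :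
      (∀ k : ℝ, 0 ≤ k → ∃ d : ℝ,
        HasDerivWithinAt (failProb G D c x y) d (Set.Ici k) k ∧
          0 ≤ d ∧ d ≤ (G.identify x y).treeGen c / G.treeGen c) ∧
      (∀ k : ℝ, 0 < k → ∃ d : ℝ,
        HasDerivWithinAt (failProb G D c x y) d (Set.Iic k) k ∧
          0 ≤ d ∧ d ≤ (G.identify x y).treeGen c / G.treeGen c) ∧
      (∃ K : ℝ, 0 < K ∧ IsLeast {k : ℝ | 0 ≤ k ∧ failProb G D c x y k = 1} K ∧
        ∀ k : ℝ, 0 < k → k ≠ K → DifferentiableAt ℝ (failProb G D c x y) k) ∧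
      HasDerivWithinAt (failProb G D c x y)
        ((G.identify x y).treeGen c / G.treeGen c) (Set.Ici 0) 0 ∧
      (∀ k : ℝ, 0 ≤ k →
        1 - k * ((G.identify x y).treeGen c / G.treeGen c) ≤
          successProb G D c x y k) := by
  obtain _ | n := n
  · exact absurd ((Fintype.card_le_one_iff.1 hn.le) x y) hxy
  obtain ⟨σ, hσ, h0⟩ := exists_isEnumeration hn hxy
  obtain ⟨T, hT⟩ := exists_isSpanningTree_of_treeGen_pos hpos
  obtain ⟨B, hB⟩ := hD.exists_linearEquiv hσ hT
  set b := G.incidence ℝ σ with hb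
  set Z := zonotope b c with hZ
  have hvolZ : volume.real Z = G.treeGen c := volume_zonotope_incidence hσ hc
  have hZc : IsCompact Z := isCompact_zonotope b c
  set Z' := zonotope (splitFirst n ∘ b) c with hZ'
  have himg : splitFirst n '' Z = Z' := image_zonotope (splitFirst n).toLinearMap b c
  have hZ'c : IsCompact Z' := isCompact_zonotope _ c
  have hvolZ' : (volume.prod volume).real Z' = G.treeGen c := by
    rw [← hvolZ, measureReal_def, measureReal_def, volume_eq_prod_splitFirst, himg]
  -- The shadow of `Z` along the coordinate of `y` is the zonotope of the identified graph.
  have hsnd : volume.real (Prod.snd '' Z') = (G.identify x y).treeGen c := by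
    rw [← volume_zonotope_incidence (hσ.identify h0) (G := G.identify x y) hc]
    congr 1
    rw [hZ', show Prod.snd '' zonotope (splitFirst n ∘ b) c = _ from
      image_zonotope (LinearMap.snd ℝ ℝ (Fin n → ℝ)) _ c]
    congr 1
    funext e
    rw [incidence_identify hσ h0]
    rfl
  have hfail : ∀ k, failProb G D c x y k =
      volume.real {z | z ∈ Z ∧ z - k • Pi.single 0 1 ∉ Z} / G.treeGen c := by
    intro k
    rw [failProb, prob_eq hB, ← hvolZ, ← score_image_configurations]
    congr 4
    ext w
    exact and_congr_right fun hw => not_congr (succeeds_iff hσ h0 hw k)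
  have hsucc : ∀ k, successProb G D c x y k = 1 - failProb G D c x y k := by
    intro k
    have h1 : successProb G D c x y k =
        volume.real {z | z ∈ Z ∧ z - k • Pi.single 0 1 ∈ Z} / G.treeGen c := by
      rw [successProb, prob_eq hB, ← hvolZ, ← score_image_configurations]
      congr 4
      ext w
      exact and_congr_right fun hw => succeeds_iff hσ h0 hw k
    have hm : MeasurableSet {z : Fin (n + 1) → ℝ | z - k • Pi.single 0 1 ∈ Z} :=
      (hZc.isClosed.preimage (f := fun z : Fin (n + 1) → ℝ => z - k • Pi.single 0 1)
        (by fun_prop)).measurableSet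
    have h2 := measureReal_inter_add_sdiff (μ := volume) (s := Z) hm hZc.measure_lt_top.ne
    rw [hvolZ] at h2
    rw [h1, hfail, eq_sub_iff_add_eq, ← add_div, div_eq_one_iff_eq hpos.ne']
    exact h2
  set F : ℝ → ℝ := fun k => (volume.prod volume).real
    {z : ℝ × (Fin n → ℝ) | z ∈ Z' ∧ (z.1 - k, z.2) ∉ Z'} with hF
  have hfF : failProb G D c x y = fun k => F k / G.treeGen c := by
    funext k
    simp only [hfail, hF]
    rw [measureReal_def, measureReal_def, volume_eq_prod_splitFirst]
    congr 3
    rw [LinearEquiv.image_eq_preimage_symm]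
    ext z
    have h1 : ∀ z, z ∈ Z' ↔ (splitFirst n).symm z ∈ Z := fun z => by
      rw [← himg, LinearEquiv.image_eq_preimage_symm, mem_preimage]
    have h2 : (z.1 - k, z.2) = z - k • splitFirst n (Pi.single 0 1) := by
      ext i
      · simp [splitFirst]
      · simp [splitFirst, Fin.tail]
    simp only [mem_preimage, mem_ofPred_eq, h1, h2, map_sub, map_smul, LinearEquiv.symm_apply_apply]
  obtain ⟨p1, p2, ⟨K, hK, ⟨hK1, hK2⟩, hK3⟩, p4, p5⟩ := measure_diff_translate_properties volume
    hZ'c (convex_zonotope _ c) (by rw [hvolZ']; exact hpos) (F := F) (fun k _ => rfl)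
  rw [hvolZ'] at hK1 hK2
  rw [hsnd] at p1 p2 p4 p5
  have hone : ∀ k, F k / G.treeGen c = 1 ↔ F k = G.treeGen c := fun k =>
    div_eq_one_iff_eq hpos.ne'
  refine ⟨fun k hk => ?_, fun k hk => ?_, ⟨K, hK, ⟨?_, ?_⟩, fun k hk hkK => ?_⟩, ?_, fun k hk => ?_⟩
  · obtain ⟨d, hd, hd0, hd1⟩ := p1 k hk
    exact ⟨d / G.treeGen c, hfF ▸ hd.div_const _, by positivity, by gcongr⟩
  · obtain ⟨d, hd, hd0, hd1⟩ := p2 k hk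
    exact ⟨d / G.treeGen c, hfF ▸ hd.div_const _, by positivity, by gcongr⟩
  · exact ⟨hK1.1, by rw [hfF]; exact (hone K).2 hK1.2⟩
  · rintro k ⟨hk, hk1⟩
    rw [hfF] at hk1
    exact hK2 ⟨hk, (hone k).1 hk1⟩
  · rw [hfF]
    exact (hK3 k hk hkK).div_const _
  · exact hfF ▸ p4.div_const _
  · rw [hsucc, hfF, ← mul_div_assoc]
    have := div_le_div_of_nonneg_right (p5 k hk) hpos.le
    simp only
    linarith

end CreditNetwork

end

/-! ### Effective resistance by Schur complements. -/

section

open Set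

namespace CreditNetwork

open MGraph

section Elimination

variable {N : ℕ}

/-- The Schur complement step that eliminates the coordinate `v`. -/
noncomputable def eliminate (A : Matrix (Fin N) (Fin N) ℝ) (v : Fin N) :
    Matrix (Fin N) (Fin N) ℝ :=
  Matrix.of fun i j => A i j - A v j * (A i v / A v v)

/-- The invariant of the elimination of all coordinates but `x` and `y`, where the coordinates below
`v` have been treated: `h` is a potential with `h x = 0` that sends a unit current from `y` to `x`,
and the remaining matrix is positive definite away from `x`. -/
structure EliminationInvariant (x y : Fin N) (h : Fin N → ℝ) (v : ℕ)
    (A : Matrix (Fin N) (Fin N) ℝ) : Prop where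
  symm : ∀ i j, A i j = A j i
  zero : ∀ i : Fin N, i.val < v → i ≠ x → i ≠ y → ∀ j, A i j = 0
  solve : ∀ i : Fin N, (i.val < v → i = y) → i ≠ x →
    ∑ j, A i j * h j = if i = y then 1 else 0
  pos : ∀ u : Fin N → ℝ, u x = 0 → (∀ i : Fin N, i.val < v → i ≠ x → i ≠ y → u i = 0) → u ≠ 0 →
    0 < ∑ i, ∑ j, u i * (A i j * u j)

variable {x y : Fin N} {h : Fin N → ℝ} {A : Matrix (Fin N) (Fin N) ℝ}

theorem EliminationInvariant.skip {v : Fin N} (hA : EliminationInvariant x y h v A)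
    (hv : v = x ∨ v = y) : EliminationInvariant x y h (v + 1) A := by
  have hlt : ∀ i : Fin N, i.val < v + 1 → i ≠ x → i ≠ y → i.val < v := by
    intro i hi hx hy
    rcases Nat.lt_succ_iff_lt_or_eq.1 hi with h | h
    · exact h
    · rcases Fin.ext h ▸ hv with h | h
      · exact absurd h hx
      · exact absurd h hy
  refine ⟨hA.symm, fun i hi hx hy => hA.zero i (hlt i hi hx hy) hx hy, fun i hi hx => ?_,
    fun u hux hu hne => hA.pos u hux (fun i hi hx hy => hu i (hi.trans (Nat.lt_succ_self _)) hx hy)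
      hne⟩
  exact hA.solve i (fun h => hi (h.trans (Nat.lt_succ_self _))) hx

theorem EliminationInvariant.pivot_pos {v : Fin N} (hA : EliminationInvariant x y h v A)
    (hx : v ≠ x) : 0 < A v v := by
  have := hA.pos (Pi.single v 1) (by simp [hx.symm])
    (fun i hi _ _ => by
      have : i ≠ v := fun h => hi.ne (congrArg _ h)
      simp [this]) (by simp)
  rw [Finset.sum_eq_single v (fun i _ hi => by simp [hi]) (by simp),
    Finset.sum_eq_single v (fun i _ hi => by simp [hi]) (by simp)] at this
  simpa using this

/-- Subtracting multiples of row `v` keeps the linear system because its right-hand side at `v ≠ y`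
is `0`. Positive definiteness survives by completing the square. -/
theorem EliminationInvariant.eliminate {v : Fin N} (hA : EliminationInvariant x y h v A)
    (hx : v ≠ x) (hy : v ≠ y) :
    EliminationInvariant x y h (v + 1) (CreditNetwork.eliminate A v) := by
  have hp := hA.pivot_pos hx
  have hlt : ∀ i : Fin N, i.val < v + 1 → i.val < v ∨ i = v := fun i hi => by
    rcases Nat.lt_succ_iff_lt_or_eq.1 hi with h | h
    · exact Or.inl h
    · exact Or.inr (Fin.ext h)
  refine ⟨fun i j => ?_, fun i hi hix hiy j => ?_, fun i hi hix => ?_, fun u hux hu hne => ?_⟩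
  · simp only [CreditNetwork.eliminate, Matrix.of_apply]
    rw [hA.symm i j, hA.symm i v, hA.symm v j]
    ring
  · simp only [CreditNetwork.eliminate, Matrix.of_apply]
    rcases hlt i hi with h | rfl
    · rw [hA.zero i h hix hiy, hA.zero i h hix hiy]
      simp
    · rw [div_self hp.ne']
      ring
  · have h1 := hA.solve i (fun h => hi (h.trans (Nat.lt_succ_self _))) hix
    have h2 := hA.solve v (fun h => absurd h (lt_irrefl _)) hx
    rw [if_neg hy] at h2
    simp only [CreditNetwork.eliminate, Matrix.of_apply, sub_mul, Finset.sum_sub_distrib, h1]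
    have : ∑ j, A v j * (A i v / A v v) * h j = (∑ j, A v j * h j) * (A i v / A v v) := by
      rw [Finset.sum_mul]
      exact Finset.sum_congr rfl fun j _ => by ring
    rw [this, h2]
    ring
  · set r := ∑ j, A v j * u j with hr
    have huv : u v = 0 := hu v (Nat.lt_succ_self _) hx hy
    -- This `t` minimises the old quadratic form over the coordinate `v`; the minimum is the new
    -- form at `u`.
    set t := -r / A v v with ht
    set w : Fin N → ℝ := u + Pi.single v t with hw
    have hwne : w ≠ 0 := by
      obtain ⟨i, hi⟩ := Function.ne_iff.1 hne
      intro h0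
      have := congrFun h0 i
      have hiv : i ≠ v := fun h => hi (h ▸ huv)
      exact hi (by simpa [hw, hiv] using this)
    have h1 := hA.pos w (by simp [hw, hux, hx.symm]) (fun i hi hix hiy => by
      have hiv : i ≠ v := fun h => hi.ne (congrArg _ h)
      simp [hw, hiv, hu i (hi.trans (Nat.lt_succ_self _)) hix hiy]) hwne
    have h2 : ∀ i, ∑ j, w i * (A i j * w j) = w i * (∑ j, A i j * u j + A i v * t) := by
      intro i
      rw [← Finset.mul_sum]
      congr 1
      simp only [hw, Pi.add_apply, mul_add, Finset.sum_add_distrib]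
      congr 1
      rw [Finset.sum_eq_single v (fun j _ hj => by simp [hj]) (by simp)]
      simp
    have h3 : ∑ i, ∑ j, w i * (A i j * w j) =
        ∑ i, u i * (∑ j, A i j * u j + A i v * t) + t * (r + A v v * t) := by
      simp only [h2]
      simp only [hw, Pi.add_apply, add_mul, Finset.sum_add_distrib]
      congr 1
      rw [Finset.sum_eq_single v (fun j _ hj => by simp [hj]) (by simp)]
      simp [hr]
    have h4 : r + A v v * t = 0 := by
      rw [ht]; field_simp; ring
    rw [h3, h4, mul_zero, add_zero] at h1
    convert h1 using 2 with i
    rw [← Finset.mul_sum]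
    congr 1
    simp only [CreditNetwork.eliminate, Matrix.of_apply, sub_mul, Finset.sum_sub_distrib]
    have : ∑ j, A v j * (A i v / A v v) * u j = r * (A i v / A v v) := by
      rw [hr, Finset.sum_mul]
      exact Finset.sum_congr rfl fun j _ => by ring
    rw [this, ht]
    ring

/-- In the row of `y` all entries outside `x` and `y` are zero by symmetry, and `h x = 0` removes
the entry at `x`. -/
theorem EliminationInvariant.final (hA : EliminationInvariant x y h N A) (hxy : x ≠ y)
    (hx : h x = 0) : A y y ≠ 0 ∧ h y = 1 / A y y := by
  have h1 := hA.solve y (fun _ => rfl) hxy.symm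
  rw [if_pos rfl, Finset.sum_eq_single y] at h1
  · have h0 : A y y ≠ 0 := fun h0 => by simp [h0] at h1
    exact ⟨h0, by rw [eq_div_iff h0, mul_comm]; exact h1⟩
  · intro j _ hj
    by_cases hjx : j = x
    · rw [hjx, hx, mul_zero]
    · rw [hA.symm, hA.zero j j.2 hjx hj, zero_mul]
  · simp

end Elimination

/-- The weighted Laplacian of a graph. -/
noncomputable def laplacian {N m : ℕ} (G : MGraph (Fin N) (Fin m)) (c : Fin m → ℝ) :
    Matrix (Fin N) (Fin N) ℝ :=
  Matrix.of fun i j => ∑ e, c e * (G.incidence ℝ id e i * G.incidence ℝ id e j)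

theorem MGraph.IsEnumeration.sum_eq {V : Type*} [Fintype V] {n : ℕ} {σ : Fin n → V} {r : V}
    (hσ : IsEnumeration σ r) (f : V → ℝ) : ∑ v, f v = f r + ∑ i, f (σ i) := by
  classical
  rw [← Finset.add_sum_erase _ _ (Finset.mem_univ r)]
  congr 1
  rw [← Finset.sum_image fun i _ j _ h => hσ.injective h]
  refine Finset.sum_congr ?_ fun _ _ => rfl
  ext v
  have := hσ.mem_range_iff v
  simp only [mem_range] at this
  simp [this]

theorem incidence_comp {N m n : ℕ} (G : MGraph (Fin N) (Fin m)) (σ : Fin n → Fin N) (e : Fin m)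
    (i : Fin n) : G.incidence ℝ id e (σ i) = G.incidence ℝ σ e i := by
  simp [incidence, vertexVec]

theorem sum_laplacian_mul {N m : ℕ} (G : MGraph (Fin N) (Fin m)) (c : Fin m → ℝ) (u : Fin N → ℝ)
    (i : Fin N) : ∑ j, laplacian G c i j * u j =
      ∑ e, c e * (G.incidence ℝ id e i * (u (G.tgt e) - u (G.src e))) := by
  simp only [laplacian, Matrix.of_apply, Finset.sum_mul]
  rw [Finset.sum_comm]
  refine Finset.sum_congr rfl fun e _ => ?_
  have : u (G.tgt e) - u (G.src e) = ∑ j, G.incidence ℝ id e j * u j := by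
    simp [incidence, vertexVec, sub_mul]
  rw [this, Finset.mul_sum, Finset.mul_sum]
  exact Finset.sum_congr rfl fun j _ => by ring

/-- `h` is the grounded voltage for a unit current, and its value at `y` is the effective
resistance. -/
theorem exists_eliminationInvariant_laplacian {N m : ℕ} (G : MGraph (Fin N) (Fin m)) {c : Fin m → ℝ}
    (hc : ∀ e, 0 ≤ c e) (hpos : 0 < G.treeGen c) {x y : Fin N} (hxy : x ≠ y) :
    ∃ h : Fin N → ℝ, h x = 0 ∧ h y = (G.identify x y).treeGen c / G.treeGen c ∧
      EliminationInvariant x y h 0 (laplacian G c) := by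
  obtain ⟨n, rfl⟩ : ∃ n, N = n + 2 := by
    obtain _ | _ | n := N
    · exact x.elim0
    · exact absurd (Fin.ext (by omega)) hxy
    · exact ⟨n, rfl⟩
  obtain ⟨σ, hσ, h0⟩ := exists_isEnumeration (n := n) (by simp) hxy
  set L : Matrix (Fin (n + 1)) (Fin (n + 1)) ℝ :=
    Matrix.of fun i j => ∑ e, c e * (G.incidence ℝ σ e i * G.incidence ℝ σ e j) with hL
  have hdet : L.det = G.treeGen c := det_laplacian_eq_treeGen hσ c
  have hlap : ∀ i j, laplacian G c (σ i) (σ j) = L i j := fun i j => by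
    simp [laplacian, hL, incidence_comp]
  have hsum : ∀ (u : Fin (n + 2) → ℝ) i, u x = 0 →
      ∑ j, laplacian G c (σ i) j * u j = (L.mulVec (u ∘ σ)) i := by
    intro u i hu
    rw [hσ.sum_eq, hu, mul_zero, zero_add]
    simp only [hlap]
    rfl
  -- Cramer's rule: the column of the inverse of `L` that belongs to `y`.
  set a : Fin (n + 1) → ℝ := fun i => L.adjugate i 0 / L.det with ha
  have ha0 : a 0 = (G.identify x y).treeGen c / G.treeGen c := by
    rw [ha, ← hdet, ← det_laplacian_eq_treeGen (hσ.identify h0)]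
    simp only [incidence_identify hσ h0]
    -- The cofactor deletes the row and column of `y`, which leaves the reduced Laplacian of the
    -- identified graph.
    rw [Matrix.adjugate_fin_succ_eq_det_submatrix]
    simp only [Fin.val_zero, add_zero, pow_zero, one_mul, Fin.succAbove_zero]
    rfl
  have hsolve : L.mulVec a = Pi.single 0 1 := by
    have h1 := congrFun (congrArg Matrix.transpose (Matrix.mul_adjugate L)) 0
    funext i
    have h2 := congrFun h1 i
    simp only [Matrix.transpose_apply, Matrix.mul_apply, Matrix.smul_apply, smul_eq_mul,
      Matrix.one_apply] at h2
    simp only [Matrix.mulVec, dotProduct, ha, mul_div_assoc', ← Finset.sum_div, h2,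
      Pi.single_apply]
    rw [mul_div_assoc, mul_comm, div_mul_cancel₀ _ (hdet ▸ hpos.ne')]
  set h : Fin (n + 2) → ℝ := fun v => ∑ i, vertexVec ℝ σ v i * a i with hh
  have hhx : h x = 0 := by simp [hh, vertexVec_root hσ]
  have hhσ : ∀ i, h (σ i) = a i := fun i => by
    simp only [hh, vertexVec_apply_enum hσ]
    rw [Finset.sum_eq_single i (fun j _ hj => by simp [hj]) (by simp)]
    simp
  refine ⟨h, hhx, by rw [← ha0, ← h0, hhσ], ⟨fun i j => ?_, fun i hi => absurd hi (by simp),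
    fun i _ hi => ?_, fun u hux _ hne => ?_⟩⟩
  · simp only [laplacian, Matrix.of_apply]
    exact Finset.sum_congr rfl fun e _ => by ring
  · obtain ⟨i, rfl⟩ := (hσ.mem_range_iff i).2 hi
    have : h ∘ σ = a := funext hhσ
    rw [hsum h i hhx, this, hsolve, ← h0]
    by_cases hi0 : i = 0
    · subst hi0; simp
    · have : σ i ≠ σ 0 := fun h => hi0 (hσ.injective h)
      simp [hi0, this]
  -- The form is the Dirichlet energy. If it vanishes, `L` kills `u`, and `u = 0` because `det L =
  -- Γ(c)` is not zero.
  · have hq : ∑ i, ∑ j, u i * (laplacian G c i j * u j) =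
        ∑ e, c e * (u (G.tgt e) - u (G.src e)) ^ 2 := by
      simp only [← Finset.mul_sum, sum_laplacian_mul]
      simp only [Finset.mul_sum]
      rw [Finset.sum_comm]
      refine Finset.sum_congr rfl fun e _ => ?_
      have : u (G.tgt e) - u (G.src e) = ∑ j, G.incidence ℝ id e j * u j := by
        simp [incidence, vertexVec, sub_mul]
      rw [sq]
      nth_rw 3 [this]
      rw [Finset.mul_sum, Finset.mul_sum]
      exact Finset.sum_congr rfl fun j _ => by ring
    have hnn : ∀ e ∈ Finset.univ, 0 ≤ c e * (u (G.tgt e) - u (G.src e)) ^ 2 := fun e _ =>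
      mul_nonneg (hc e) (sq_nonneg _)
    rw [hq]
    refine lt_of_le_of_ne (Finset.sum_nonneg hnn) fun h0 => hne ?_
    have hz := (Finset.sum_eq_zero_iff_of_nonneg hnn).1 h0.symm
    have hLu : L.mulVec (u ∘ σ) = 0 := by
      funext i
      rw [← hsum u i hux, sum_laplacian_mul]
      refine Finset.sum_eq_zero fun e he => ?_
      rcases mul_eq_zero.1 (hz e he) with h | h
      · rw [h, zero_mul]
      · rw [pow_eq_zero_iff (by norm_num)] at h
        rw [h, mul_zero, mul_zero]
    have hu0 : u ∘ σ = 0 := by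
      by_contra hne'
      exact (hdet ▸ hpos.ne') (Matrix.exists_mulVec_eq_zero_iff.1 ⟨_, hne', hLu⟩)
    funext w
    by_cases hw : w = x
    · rw [hw, hux]; rfl
    · obtain ⟨i, rfl⟩ := (hσ.mem_range_iff w).2 hw
      exact congrFun hu0 i

end CreditNetwork

end

/-! ### The program, its correctness and its running time. -/

section

open Set

namespace RealRAM

open CreditNetwork MGraph

/-- Started in `s`, the program `p` halts after at most `T` steps in a state that satisfies `Q`. -/
def HaltsWithin (p : Program) (s : State) (T : ℕ) (Q : State → Prop) : Prop :=
  ∃ s' t, Runs p s s' t ∧ t ≤ T ∧ Q s'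

theorem HaltsWithin.mono {p : Program} {s : State} {T T' : ℕ} {Q Q' : State → Prop}
    (h : HaltsWithin p s T Q) (hT : T ≤ T') (hQ : ∀ s', Q s' → Q' s') :
    HaltsWithin p s T' Q' := by
  obtain ⟨s', t, hr, ht, hs⟩ := h
  exact ⟨s', t, hr, ht.trans hT, hQ _ hs⟩

theorem HaltsWithin.seq {p q : Program} {s : State} {T T' : ℕ} {Q R : State → Prop}
    (hp : HaltsWithin p s T R) (hq : ∀ s', R s' → HaltsWithin q s' T' Q) :
    HaltsWithin (.seq p q) s (T + T') Q := by
  obtain ⟨s', t, hr, ht, hs⟩ := hp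
  obtain ⟨s'', t', hr', ht', hs'⟩ := hq s' hs
  exact ⟨s'', t + t', .seq hr hr', add_le_add ht ht', hs'⟩

theorem HaltsWithin.branch {b : Test} {p q : Program} {s : State} {T : ℕ} {Q : State → Prop}
    (hp : b.Holds s → HaltsWithin p s T Q) (hq : ¬ b.Holds s → HaltsWithin q s T Q) :
    HaltsWithin (.branch b p q) s (1 + T) Q := by
  by_cases hb : b.Holds s
  · obtain ⟨s', t, hr, ht, hs⟩ := hp hb
    exact ⟨s', 1 + t, .branchTrue hb hr, by omega, hs⟩
  · obtain ⟨s', t, hr, ht, hs⟩ := hq hb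
    exact ⟨s', 1 + t, .branchFalse hb hr, by omega, hs⟩

/-- Register `i` counts the rounds up to `n`. Each round pays for one test, and the last summand `1`
is the failing test. -/
theorem HaltsWithin.loop {p : Program} {i j n T : ℕ} (I : ℕ → State → Prop)
    (hbound : ∀ k s, I k s → s.natReg i = k ∧ s.natReg j = n)
    (hstep : ∀ k s, k < n → I k s → HaltsWithin p s T (I (k + 1))) {s : State} (hs : I 0 s) :
    HaltsWithin (.loop (.natLt i j) p) s (n * (T + 1) + 1) (I n) := by
  have key : ∀ d k s, k + d = n → I k s →
      HaltsWithin (.loop (.natLt i j) p) s (d * (T + 1) + 1) (I n) := by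
    intro d
    induction d with
    | zero =>
      intro k s hk hI
      obtain ⟨h1, h2⟩ := hbound k s hI
      refine ⟨s, 1, .loopFalse ?_, by omega, by simpa [← hk] using hI⟩
      simp [Test.Holds, h1, h2, ← hk]
    | succ d ih =>
      intro k s hk hI
      obtain ⟨h1, h2⟩ := hbound k s hI
      obtain ⟨s', t, hr, ht, hs'⟩ := hstep k s (by omega) hI
      obtain ⟨s'', t', hr', ht', hs''⟩ := ih (k + 1) s' (by omega) hs'
      refine ⟨s'', 1 + t + t', .loopTrue ?_ hr hr', ?_, hs''⟩
      · simp only [Test.Holds, h1, h2]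
        omega
      · rw [add_mul]
        omega
  exact key n 0 s (zero_add n) hs

/-- The program that executes a nonempty list of instructions. -/
def straight : Instr → List Instr → Program
  | a, [] => .instr a
  | a, b :: l => .seq (.instr a) (straight b l)

/-- All instructions of a list can be executed one after the other. -/
def LegalFrom : List Instr → State → Prop
  | [], _ => True
  | a :: l, s => a.Legal s ∧ LegalFrom l (a.result s)

/-- The effect of a list of instructions. -/
noncomputable def resultList : List Instr → State → State
  | [], s => s
  | a :: l, s => resultList l (a.result s)

theorem haltsWithin_straight {a : Instr} {l : List Instr} {s : State} {Q : State → Prop}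
    (hl : LegalFrom (a :: l) s) (hQ : Q (resultList (a :: l) s)) :
    HaltsWithin (straight a l) s (l.length + 1) Q := by
  induction l generalizing a s with
  | nil => exact ⟨_, 1, .instr hl.1, le_rfl, hQ⟩
  | cons b l ih =>
    have h1 : HaltsWithin (.instr a) s 1 (· = a.result s) := ⟨_, 1, .instr hl.1, le_rfl, rfl⟩
    refine (h1.seq (T' := l.length + 1) fun s' hs' => ?_).mono (by simp; omega) fun _ h => h
    subst hs'
    exact ih hl.2 hQ

/-- Adds `a` to one cell of the real memory. -/
noncomputable def addCell (M : ℕ → ℕ → ℝ) (i j : ℕ) (a : ℝ) : ℕ → ℕ → ℝ :=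
  Function.update M i (Function.update (M i) j (M i j + a))

theorem addCell_apply (M : ℕ → ℕ → ℝ) (i j : ℕ) (a : ℝ) (r l : ℕ) :
    addCell M i j a r l = M r l + if r = i ∧ l = j then a else 0 := by
  unfold addCell
  by_cases h : r = i
  · subst h
    by_cases h' : l = j
    · subst h'; simp
    · simp [h']
  · simp [h]

/-- The registers that keep their values from the start: the number `N` of vertices, the vertices
`x` and `y`, the constants `0` and `1`, and the transaction size. -/
structure Fixed (N x y : ℕ) (k : ℝ) (s : State) : Prop where
  size : s.natReg 0 = N
  source : s.natReg 2 = x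
  target : s.natReg 3 = y
  zero : s.natReg 4 = 0
  one : s.natReg 5 = 1
  amount : s.realReg 0 = k

/-- Rows `b, …, b + N - 1` of the real memory hold the matrix `A`. -/
def Holds {N : ℕ} (b : ℕ) (A : Matrix (Fin N) (Fin N) ℝ) (s : State) : Prop :=
  ∀ i j : Fin N, s.realMem (b + i) j = A i j

/-- Adds one edge to the Laplacian. -/
def edgeBody : Program :=
  straight (.natLoad 12 4 6) [.natLoad 13 5 6, .natAdd 7 12 5, .natAdd 8 13 5, .realLoad 1 4 6,
    .realLoad 2 7 12, .realAdd 2 2 1, .realStore 7 12 2,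
    .realLoad 2 8 13, .realAdd 2 2 1, .realStore 8 13 2,
    .realLoad 2 7 13, .realSub 2 2 1, .realStore 7 13 2,
    .realLoad 2 8 12, .realSub 2 2 1, .realStore 8 12 2,
    .natAdd 6 6 5]

/-- Writes the Laplacian into the rows `1, …, N` of the real memory. -/
def laplacianProgram : Program :=
  .seq (.instr (.natConst 5 1)) (.loop (.natLt 6 1) edgeBody)

/-- Computes one entry of the eliminated matrix. -/
def entryBody : Program :=
  straight (.realLoad 3 11 8) [.realMul 3 3 2, .realLoad 4 9 8, .realSub 4 4 3, .realStore 10 8 4,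
    .natAdd 8 8 5]

/-- Computes one row of the eliminated matrix. -/
def rowBody : Program :=
  .seq (straight (.realLoad 2 9 6) [.realDiv 2 2 1, .natConst 8 0])
    (.seq (.loop (.natLt 8 0) entryBody)
      (straight (.natAdd 7 7 5) [.natAdd 9 9 5, .natAdd 10 10 5]))

/-- Eliminates one coordinate. -/
def eliminateProgram : Program :=
  .seq (straight (.natAdd 11 9 6) [.realLoad 1 11 6, .natConst 7 0, .natAdd 10 9 0])
    (.loop (.natLt 7 0) rowBody)

/-- Serves as a no-op: register `7` is scratch and is reset at the start of every elimination. -/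
def skipProgram : Program := .instr (.natConst 7 0)

/-- Eliminates the current coordinate unless it is one of the two ends of the transaction. -/
def vertexBody : Program :=
  .seq (.branch (.natLt 6 2) (.branch (.natLt 6 3) eliminateProgram
      (.branch (.natLt 3 6) eliminateProgram skipProgram))
    (.branch (.natLt 2 6) (.branch (.natLt 6 3) eliminateProgram
      (.branch (.natLt 3 6) eliminateProgram skipProgram)) skipProgram))
    (.instr (.natAdd 6 6 5))

/-- Computes the lower bound for the success probability. -/
def boundProgram : Program :=
  .seq laplacianProgram (.seq (straight (.natConst 6 0) [.natConst 9 1])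
    (.seq (.loop (.natLt 6 0) vertexBody)
      (straight (.natAdd 11 9 3) [.realLoad 1 11 3, .realDiv 2 0 1, .realConst 1 1,
        .realSub 0 1 2])))

/-! ### Building the Laplacian edge by edge. -/

section Laplacian

variable {N m : ℕ} (G : MGraph (Fin N) (Fin m)) (c : Fin m → ℝ) (x y : Fin N) (k : ℝ)

/-- The Laplacian of the first `l` edges. -/
noncomputable def partialLaplacian (l : ℕ) : Matrix (Fin N) (Fin N) ℝ :=
  Matrix.of fun i j => ∑ e, if e.val < l then
    c e * (G.incidence ℝ id e i * G.incidence ℝ id e j) else 0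

theorem partialLaplacian_succ {l : ℕ} (hl : l < m) (i j : Fin N) :
    partialLaplacian G c (l + 1) i j = partialLaplacian G c l i j +
      c ⟨l, hl⟩ * (G.incidence ℝ id ⟨l, hl⟩ i * G.incidence ℝ id ⟨l, hl⟩ j) := by
  simp only [partialLaplacian, Matrix.of_apply]
  rw [← Finset.add_sum_erase _ _ (Finset.mem_univ (⟨l, hl⟩ : Fin m)),
    ← Finset.add_sum_erase (Finset.univ) (fun e : Fin m => if e.val < l then _ else _)
      (Finset.mem_univ (⟨l, hl⟩ : Fin m))]
  simp only [Nat.lt_succ_self, if_true, lt_irrefl, if_false, zero_add]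
  rw [add_comm]
  congr 1
  refine Finset.sum_congr rfl fun e he => ?_
  have hne : e.val ≠ l := fun h => Finset.ne_of_mem_erase he (Fin.ext h)
  refine if_congr ?_ rfl rfl
  omega

structure EdgeInvariant (l : ℕ) (s : State) : Prop where
  fixed : Fixed N x y k s
  edges : s.natReg 1 = m
  counter : s.natReg 6 = l
  src : ∀ e : Fin m, s.natMem 0 e = G.src e
  tgt : ∀ e : Fin m, s.natMem 1 e = G.tgt e
  capacity : ∀ e : Fin m, s.realMem 0 e = c e
  matrix : Holds 1 (partialLaplacian G c l) s

theorem edgeBody_spec {l : ℕ} {s : State} (hl : l < m) (hs : EdgeInvariant G c x y k l s) :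
    HaltsWithin edgeBody s 18 (EdgeInvariant G c x y k (l + 1)) := by
  obtain ⟨⟨f0, f2, f3, f4, f5, fk⟩, h1, h6, hsrc, htgt, hcap, hM⟩ := hs
  have hsl := hsrc ⟨l, hl⟩
  have htl := htgt ⟨l, hl⟩
  have hcl := hcap ⟨l, hl⟩
  simp only at hsl htl hcl
  set u := G.src ⟨l, hl⟩ with hu
  set w := G.tgt ⟨l, hl⟩ with hw
  set a := c ⟨l, hl⟩ with ha
  -- Row `0` holds the capacities, so the matrix starts at row `1` and the vertex numbers are
  -- shifted by one.
  have hmem : (resultList [.natLoad 12 4 6, .natLoad 13 5 6, .natAdd 7 12 5, .natAdd 8 13 5,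
      .realLoad 1 4 6, .realLoad 2 7 12, .realAdd 2 2 1, .realStore 7 12 2,
      .realLoad 2 8 13, .realAdd 2 2 1, .realStore 8 13 2,
      .realLoad 2 7 13, .realSub 2 2 1, .realStore 7 13 2,
      .realLoad 2 8 12, .realSub 2 2 1, .realStore 8 12 2, .natAdd 6 6 5] s).realMem =
      addCell (addCell (addCell (addCell s.realMem (u + 1) u a) (w + 1) w a) (u + 1) w (-a))
        (w + 1) u (-a) := by
    simp [resultList, Instr.result, State.setNat, State.setReal, State.setRealMem, h6, f4, f5, hsl,
      htl, hcl, addCell, sub_eq_add_neg]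
  refine haltsWithin_straight ?_ ⟨⟨?_, ?_, ?_, ?_, ?_, ?_⟩, ?_, ?_, ?_, ?_, ?_, ?_⟩
  · simp [LegalFrom, Instr.Legal]
  · simpa [resultList, Instr.result, State.setNat, State.setReal, State.setRealMem] using f0
  · simpa [resultList, Instr.result, State.setNat, State.setReal, State.setRealMem] using f2
  · simpa [resultList, Instr.result, State.setNat, State.setReal, State.setRealMem] using f3
  · simpa [resultList, Instr.result, State.setNat, State.setReal, State.setRealMem] using f4
  · simpa [resultList, Instr.result, State.setNat, State.setReal, State.setRealMem] using f5
  · simpa [resultList, Instr.result, State.setNat, State.setReal, State.setRealMem] using fk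
  · simpa [resultList, Instr.result, State.setNat, State.setReal, State.setRealMem] using h1
  · simp [resultList, Instr.result, State.setNat, State.setReal, State.setRealMem, h6, f5]
  · simpa [resultList, Instr.result, State.setNat, State.setReal, State.setRealMem] using hsrc
  · simpa [resultList, Instr.result, State.setNat, State.setReal, State.setRealMem] using htgt
  · intro e
    rw [hmem]
    simp [addCell_apply, hcap]
  · intro i j
    rw [hmem, partialLaplacian_succ G c hl, ← hM i j]
    simp only [addCell_apply, incidence, vertexVec, Pi.sub_apply, id, ← hu, ← hw, ← ha]
    have e1 : ∀ v : Fin N, 1 + i.val = v.val + 1 ↔ v = i := fun v => by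
      rw [Fin.ext_iff]; omega
    have e2 : ∀ v : Fin N, j.val = v.val ↔ v = j := fun v => by
      rw [Fin.ext_iff]; omega
    simp only [e1, e2]
    -- All coincidences of end points and indices are checked. A loop is included: its four updates
    -- cancel.
    rcases Classical.propComplete (u = i) with h1 | h1 <;>
      rcases Classical.propComplete (w = i) with h2 | h2 <;>
      rcases Classical.propComplete (u = j) with h3 | h3 <;>
      rcases Classical.propComplete (w = j) with h4 | h4 <;>
      simp only [h1, h2, h3, h4, if_true, if_false, and_true, and_false] <;>
      ring

theorem laplacianProgram_spec : HaltsWithin laplacianProgram (input G c x y k) (1 + (m * 19 + 1))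
    fun s => Fixed N x y k s ∧ Holds 1 (laplacian G c) s := by
  have h0 : HaltsWithin (.instr (.natConst 5 1)) (input G c x y k) 1
      (EdgeInvariant G c x y k 0) := by
    refine ⟨_, 1, .instr trivial, le_rfl, ⟨?_, ?_, ?_, ?_, ?_, ?_⟩, ?_, ?_, ?_, ?_, ?_, ?_⟩
    all_goals try simp [Instr.result, State.setNat, input]
    intro i j
    simp [partialLaplacian]
  refine h0.seq fun s hs => ?_
  refine (HaltsWithin.loop (EdgeInvariant G c x y k) (fun l s h => ⟨h.counter, h.edges⟩)
    (fun l s hl h => edgeBody_spec G c x y k hl h) hs).mono le_rfl fun s hs => ⟨hs.fixed, ?_⟩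
  intro i j
  rw [hs.matrix i j]
  simp [partialLaplacian, laplacian]

end Laplacian

/-! ### Executing the elimination. -/

section Elimination

variable {N : ℕ} {x y : Fin N} {k : ℝ} {A : Matrix (Fin N) (Fin N) ℝ} {v : Fin N} {b : ℕ}

variable (x y k A v b) in
/-- The state while row `r` of the eliminated matrix is computed and its entries before column `l`
are done. -/
structure EntryInvariant (r : Fin N) (l : ℕ) (s : State) : Prop where
  fixed : Fixed N x y k s
  vertex : s.natReg 6 = v
  row : s.natReg 7 = r
  column : s.natReg 8 = l
  old : s.natReg 9 = b + r
  new : s.natReg 10 = b + N + r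
  pivotRow : s.natReg 11 = b + v
  pivot : s.realReg 1 = A v v
  factor : s.realReg 2 = A r v / A v v
  matrix : Holds b A s
  done : ∀ i j : Fin N, (i < r ∨ i = r ∧ j.val < l) →
    s.realMem (b + N + i) j = eliminate A v i j

variable (x y k A v b) in
/-- The state when the rows of the eliminated matrix before row `r` are done. -/
structure RowInvariant (r : ℕ) (s : State) : Prop where
  fixed : Fixed N x y k s
  vertex : s.natReg 6 = v
  row : s.natReg 7 = r
  old : s.natReg 9 = b + r
  new : s.natReg 10 = b + N + r
  pivotRow : s.natReg 11 = b + v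
  pivot : s.realReg 1 = A v v
  matrix : Holds b A s
  done : ∀ i j : Fin N, i.val < r → s.realMem (b + N + i) j = eliminate A v i j

theorem entryBody_spec {r : Fin N} {l : ℕ} {s : State} (hl : l < N)
    (hs : EntryInvariant x y k A v b r l s) :
    HaltsWithin entryBody s 6 (EntryInvariant x y k A v b r (l + 1)) := by
  obtain ⟨⟨f0, f2, f3, f4, f5, fk⟩, h6, h7, h8, h9, h10, h11, g1, g2, hM, hd⟩ := hs
  have hv := hM v ⟨l, hl⟩
  have hr := hM r ⟨l, hl⟩
  simp only at hv hr
  have hmem : (resultList [.realLoad 3 11 8, .realMul 3 3 2, .realLoad 4 9 8, .realSub 4 4 3,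
      .realStore 10 8 4, .natAdd 8 8 5] s).realMem =
      Function.update s.realMem (b + N + r) (Function.update (s.realMem (b + N + r)) l
        (eliminate A v r ⟨l, hl⟩)) := by
    simp [resultList, Instr.result, State.setNat, State.setReal, State.setRealMem, h8, h9, h10,
      h11, hv, hr, g2, eliminate]
  refine haltsWithin_straight ?_ ⟨⟨?_, ?_, ?_, ?_, ?_, ?_⟩, ?_, ?_, ?_, ?_, ?_, ?_, ?_, ?_, ?_, ?_⟩
  · simp [LegalFrom, Instr.Legal]
  · simpa [resultList, Instr.result, State.setNat, State.setReal, State.setRealMem] using f0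
  · simpa [resultList, Instr.result, State.setNat, State.setReal, State.setRealMem] using f2
  · simpa [resultList, Instr.result, State.setNat, State.setReal, State.setRealMem] using f3
  · simpa [resultList, Instr.result, State.setNat, State.setReal, State.setRealMem] using f4
  · simpa [resultList, Instr.result, State.setNat, State.setReal, State.setRealMem] using f5
  · simpa [resultList, Instr.result, State.setNat, State.setReal, State.setRealMem] using fk
  · simpa [resultList, Instr.result, State.setNat, State.setReal, State.setRealMem] using h6
  · simpa [resultList, Instr.result, State.setNat, State.setReal, State.setRealMem] using h7
  · simp [resultList, Instr.result, State.setNat, State.setReal, State.setRealMem, h8, f5]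
  · simpa [resultList, Instr.result, State.setNat, State.setReal, State.setRealMem] using h9
  · simpa [resultList, Instr.result, State.setNat, State.setReal, State.setRealMem] using h10
  · simpa [resultList, Instr.result, State.setNat, State.setReal, State.setRealMem] using h11
  · simpa [resultList, Instr.result, State.setNat, State.setReal, State.setRealMem] using g1
  · simpa [resultList, Instr.result, State.setNat, State.setReal, State.setRealMem] using g2
  · intro i j
    rw [hmem, Function.update_of_ne (by omega), hM]
  · intro i j hij
    rw [hmem]
    by_cases hi : i = r
    · subst hi
      rw [Function.update_self]
      by_cases hj : j.val = l
      · subst hj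
        rw [Function.update_self]
      · rw [Function.update_of_ne hj]
        exact hd i j (Or.inr ⟨rfl, by
          rcases hij with h | h
          · exact absurd h (lt_irrefl _)
          · omega⟩)
    · have : i.val ≠ r.val := fun h => hi (Fin.ext h)
      rw [Function.update_of_ne (by omega)]
      exact hd i j (Or.inl (hij.resolve_right fun h => hi h.1))

theorem rowBody_spec {r : ℕ} {s : State} (hp : A v v ≠ 0) (hr : r < N)
    (hs : RowInvariant x y k A v b r s) :
    HaltsWithin rowBody s (3 + (N * 7 + 1 + 3)) (RowInvariant x y k A v b (r + 1)) := by
  have h0 : HaltsWithin (straight (.realLoad 2 9 6) [.realDiv 2 2 1, .natConst 8 0]) s 3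
      (EntryInvariant x y k A v b ⟨r, hr⟩ 0) := by
    obtain ⟨⟨f0, f2, f3, f4, f5, fk⟩, h6, h7, h9, h10, h11, g1, hM, hd⟩ := hs
    have hrv := hM ⟨r, hr⟩ v
    simp only at hrv
    refine haltsWithin_straight ?_
      ⟨⟨?_, ?_, ?_, ?_, ?_, ?_⟩, ?_, ?_, ?_, ?_, ?_, ?_, ?_, ?_, ?_, ?_⟩
    -- The division by the pivot is legal because the pivot is nonzero.
    · simpa [LegalFrom, Instr.Legal, Instr.result, State.setReal, g1] using hp
    · simpa [resultList, Instr.result, State.setNat, State.setReal] using f0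
    · simpa [resultList, Instr.result, State.setNat, State.setReal] using f2
    · simpa [resultList, Instr.result, State.setNat, State.setReal] using f3
    · simpa [resultList, Instr.result, State.setNat, State.setReal] using f4
    · simpa [resultList, Instr.result, State.setNat, State.setReal] using f5
    · simpa [resultList, Instr.result, State.setNat, State.setReal] using fk
    · simpa [resultList, Instr.result, State.setNat, State.setReal] using h6
    · simpa [resultList, Instr.result, State.setNat, State.setReal] using h7
    · simp [resultList, Instr.result, State.setNat, State.setReal]
    · simpa [resultList, Instr.result, State.setNat, State.setReal] using h9
    · simpa [resultList, Instr.result, State.setNat, State.setReal] using h10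
    · simpa [resultList, Instr.result, State.setNat, State.setReal] using h11
    · simpa [resultList, Instr.result, State.setNat, State.setReal] using g1
    · simp [resultList, Instr.result, State.setNat, State.setReal, h9, h6, hrv, g1]
    · exact hM
    · intro i j hij
      refine hd i j ?_
      rcases hij with h | h
      · exact h
      · exact absurd h.2 (Nat.not_lt_zero _)
  refine h0.seq fun s hs => ?_
  refine (HaltsWithin.loop (EntryInvariant x y k A v b ⟨r, hr⟩)
    (fun l s h => ⟨h.column, h.fixed.size⟩) (fun l s hl h => entryBody_spec hl h) hs).seq
    fun s hs => ?_
  obtain ⟨⟨f0, f2, f3, f4, f5, fk⟩, h6, h7, h8, h9, h10, h11, g1, g2, hM, hd⟩ := hs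
  simp only at h7 h9 h10
  refine haltsWithin_straight ?_ ⟨⟨?_, ?_, ?_, ?_, ?_, ?_⟩, ?_, ?_, ?_, ?_, ?_, ?_, ?_, ?_⟩
  · simp [LegalFrom, Instr.Legal]
  · simpa [resultList, Instr.result, State.setNat] using f0
  · simpa [resultList, Instr.result, State.setNat] using f2
  · simpa [resultList, Instr.result, State.setNat] using f3
  · simpa [resultList, Instr.result, State.setNat] using f4
  · simpa [resultList, Instr.result, State.setNat] using f5
  · simpa [resultList, Instr.result, State.setNat] using fk
  · simpa [resultList, Instr.result, State.setNat] using h6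
  · simp [resultList, Instr.result, State.setNat, h7, f5]
  · simp [resultList, Instr.result, State.setNat, h9, f5, add_assoc]
  · simp [resultList, Instr.result, State.setNat, h10, f5, add_assoc]
  · simpa [resultList, Instr.result, State.setNat] using h11
  · simpa [resultList, Instr.result, State.setNat] using g1
  · exact hM
  · intro i j hi
    refine hd i j ?_
    rcases Nat.lt_succ_iff_lt_or_eq.1 hi with h | h
    · exact Or.inl h
    · exact Or.inr ⟨Fin.ext h, j.2⟩

variable (x y k) in
/-- The state when the coordinates before `l` have been treated. -/
structure VertexInvariant (h : Fin N → ℝ) (l : ℕ) (s : State) : Prop where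
  fixed : Fixed N x y k s
  vertex : s.natReg 6 = l
  matrix : ∃ b A, s.natReg 9 = b ∧ Holds b A s ∧ EliminationInvariant x y h l A

/-- The new matrix goes into the `N` rows after the old one, so nothing is overwritten while it is
still read. -/
theorem eliminateProgram_spec {s : State} (hp : A v v ≠ 0) (hs : Fixed N x y k s)
    (h6 : s.natReg 6 = v) (h9 : s.natReg 9 = b) (hM : Holds b A s) :
    HaltsWithin eliminateProgram s (4 + (N * (3 + (N * 7 + 1 + 3) + 1) + 1)) fun s =>
      Fixed N x y k s ∧ s.natReg 6 = v ∧ s.natReg 9 = b + N ∧ Holds (b + N) (eliminate A v) s := by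
  have h0 : HaltsWithin (straight (.natAdd 11 9 6) [.realLoad 1 11 6, .natConst 7 0, .natAdd 10 9 0])
      s 4 (RowInvariant x y k A v b 0) := by
    obtain ⟨f0, f2, f3, f4, f5, fk⟩ := hs
    have hvv := hM v v
    refine haltsWithin_straight ?_ ⟨⟨?_, ?_, ?_, ?_, ?_, ?_⟩, ?_, ?_, ?_, ?_, ?_, ?_, ?_, ?_⟩
    · simp [LegalFrom, Instr.Legal]
    · simpa [resultList, Instr.result, State.setNat, State.setReal] using f0
    · simpa [resultList, Instr.result, State.setNat, State.setReal] using f2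
    · simpa [resultList, Instr.result, State.setNat, State.setReal] using f3
    · simpa [resultList, Instr.result, State.setNat, State.setReal] using f4
    · simpa [resultList, Instr.result, State.setNat, State.setReal] using f5
    · simpa [resultList, Instr.result, State.setNat, State.setReal] using fk
    · simpa [resultList, Instr.result, State.setNat, State.setReal] using h6
    · simp [resultList, Instr.result, State.setNat, State.setReal]
    · simpa [resultList, Instr.result, State.setNat, State.setReal] using h9
    · simp [resultList, Instr.result, State.setNat, State.setReal, h9, f0]
    · simp [resultList, Instr.result, State.setNat, State.setReal, h9, h6]
    · simp [resultList, Instr.result, State.setNat, State.setReal, h9, h6, hvv]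
    · exact hM
    · exact fun i j hi => absurd hi (Nat.not_lt_zero _)
  refine h0.seq fun s hs => ?_
  refine (HaltsWithin.loop (RowInvariant x y k A v b) (fun l s h => ⟨h.row, h.fixed.size⟩)
    (fun l s hl h => rowBody_spec hp hl h) hs).mono le_rfl fun s hs => ?_
  -- Register `9` advanced with every row and now points to the base `b + N` of the new matrix.
  exact ⟨hs.fixed, hs.vertex, hs.old, fun i j => hs.done i j i.2⟩

theorem vertexBody_spec {h : Fin N → ℝ} {l : ℕ} {s : State} (hl : l < N)
    (hs : VertexInvariant x y k h l s) :
    HaltsWithin vertexBody s (1 + (1 + (1 + (1 + (4 + (N * (3 + (N * 7 + 1 + 3) + 1) + 1))))) + 1)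
      (VertexInvariant x y k h (l + 1)) := by
  obtain ⟨hf, h6, b, A, h9, hM, hA⟩ := hs
  set T := 4 + (N * (3 + (N * 7 + 1 + 3) + 1) + 1) with hT
  let Q : State → Prop := fun s => Fixed N x y k s ∧ s.natReg 6 = l ∧
    ∃ b A, s.natReg 9 = b ∧ Holds b A s ∧ EliminationInvariant x y h (l + 1) A
  have hskip : l = x.val ∨ l = y.val → HaltsWithin skipProgram s T Q := by
    intro hv
    refine ⟨_, 1, .instr trivial, by omega, ⟨?_, ?_, ?_, ?_, ?_, ?_⟩, ?_, b, A, ?_, hM, ?_⟩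
    · simpa [Instr.result, State.setNat] using hf.size
    · simpa [Instr.result, State.setNat] using hf.source
    · simpa [Instr.result, State.setNat] using hf.target
    · simpa [Instr.result, State.setNat] using hf.zero
    · simpa [Instr.result, State.setNat] using hf.one
    · simpa [Instr.result, State.setNat] using hf.amount
    · simpa [Instr.result, State.setNat] using h6
    · simpa [Instr.result, State.setNat] using h9
    · exact EliminationInvariant.skip (v := ⟨l, hl⟩) hA (hv.imp Fin.ext Fin.ext)
  have helim : l ≠ x.val → l ≠ y.val → HaltsWithin eliminateProgram s T Q := by
    intro hx hy
    have hx' : (⟨l, hl⟩ : Fin N) ≠ x := fun h => hx (congrArg Fin.val h)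
    have hy' : (⟨l, hl⟩ : Fin N) ≠ y := fun h => hy (congrArg Fin.val h)
    refine (eliminateProgram_spec (v := ⟨l, hl⟩)
      (EliminationInvariant.pivot_pos (v := ⟨l, hl⟩) hA hx').ne' hf h6 h9 hM).mono le_rfl
      fun s hs => ⟨hs.1, hs.2.1, b + N, _, hs.2.2.1, hs.2.2.2,
        EliminationInvariant.eliminate (v := ⟨l, hl⟩) hA hx' hy'⟩
  -- The machine has only strict comparisons, so `l = x` and `l = y` are recognised by two failing
  -- tests each.
  have h62 : (Test.natLt 6 2).Holds s ↔ l < x := by simp [Test.Holds, h6, hf.source]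
  have h26 : (Test.natLt 2 6).Holds s ↔ x < l := by simp [Test.Holds, h6, hf.source]
  have h63 : (Test.natLt 6 3).Holds s ↔ l < y := by simp [Test.Holds, h6, hf.target]
  have h36 : (Test.natLt 3 6).Holds s ↔ y < l := by simp [Test.Holds, h6, hf.target]
  have hy : l ≠ x.val → HaltsWithin (.branch (.natLt 6 3) eliminateProgram
      (.branch (.natLt 3 6) eliminateProgram skipProgram)) s (1 + (1 + T)) Q := by
    intro hx
    refine .branch (fun hb => ?_) fun hb => .branch (fun hb' => ?_) fun hb' => ?_
    · rw [h63] at hb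
      exact (helim hx hb.ne).mono (by omega) fun _ h => h
    · rw [h36] at hb'
      exact helim hx hb'.ne'
    · rw [h63] at hb
      rw [h36] at hb'
      exact hskip (Or.inr (by omega))
  refine HaltsWithin.seq (R := Q) ?_ ?_
  · refine (HaltsWithin.branch (T := 1 + (1 + (1 + T))) (fun hb => ?_)
      fun hb => .branch (fun hb' => ?_) fun hb' => ?_).mono le_rfl fun _ h => h
    · rw [h62] at hb
      exact (hy hb.ne).mono (by omega) fun _ h => h
    · rw [h26] at hb'
      exact hy hb'.ne'
    · rw [h62] at hb
      rw [h26] at hb'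
      exact (hskip (Or.inl (by omega))).mono (by omega) fun _ h => h
  · rintro s ⟨hf, h6, b, A, h9, hM, hA⟩
    refine ⟨_, 1, .instr trivial, le_rfl, ⟨?_, ?_, ?_, ?_, ?_, ?_⟩, ?_, b, A, ?_, hM, hA⟩
    · simpa [Instr.result, State.setNat] using hf.size
    · simpa [Instr.result, State.setNat] using hf.source
    · simpa [Instr.result, State.setNat] using hf.target
    · simpa [Instr.result, State.setNat] using hf.zero
    · simpa [Instr.result, State.setNat] using hf.one
    · simpa [Instr.result, State.setNat] using hf.amount
    · simp [Instr.result, State.setNat, h6, hf.one]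
    · simpa [Instr.result, State.setNat] using h9

end Elimination

theorem boundProgram_spec {N m : ℕ} (G : MGraph (Fin N) (Fin m)) {c : Fin m → ℝ}
    (hc : ∀ e, 0 ≤ c e) (hpos : 0 < G.treeGen c) {x y : Fin N} (hxy : x ≠ y) (k : ℝ) :
    HaltsWithin boundProgram (input G c x y k) (100 * (N + m + 1) ^ 3) fun s =>
      s.realReg 0 = 1 - k * ((G.identify x y).treeGen c / G.treeGen c) := by
  obtain ⟨h, hx, hy, hinv⟩ := exists_eliminationInvariant_laplacian G hc hpos hxy
  have h1 : ∀ s, (Fixed N x y k s ∧ Holds 1 (laplacian G c) s) →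
      HaltsWithin (straight (.natConst 6 0) [.natConst 9 1]) s 2 (VertexInvariant x y k h 0) := by
    rintro s ⟨⟨f0, f2, f3, f4, f5, fk⟩, hM⟩
    refine haltsWithin_straight ?_ ⟨⟨?_, ?_, ?_, ?_, ?_, ?_⟩, ?_, 1, _, ?_, hM, hinv⟩
    · simp [LegalFrom, Instr.Legal]
    · simpa [resultList, Instr.result, State.setNat] using f0
    · simpa [resultList, Instr.result, State.setNat] using f2
    · simpa [resultList, Instr.result, State.setNat] using f3
    · simpa [resultList, Instr.result, State.setNat] using f4
    · simpa [resultList, Instr.result, State.setNat] using f5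
    · simpa [resultList, Instr.result, State.setNat] using fk
    · simp [resultList, Instr.result, State.setNat]
    · simp [resultList, Instr.result, State.setNat]
  have h2 : ∀ s, VertexInvariant x y k h N s → HaltsWithin (straight (.natAdd 11 9 3)
      [.realLoad 1 11 3, .realDiv 2 0 1, .realConst 1 1, .realSub 0 1 2]) s 5 fun s =>
      s.realReg 0 = 1 - k * ((G.identify x y).treeGen c / G.treeGen c) := by
    rintro s ⟨hf, h6, b, A, h9, hM, hA⟩
    obtain ⟨hne, hyA⟩ := hA.final hxy hx
    have hyy := hM y y
    refine haltsWithin_straight ?_ ?_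
    · simpa [LegalFrom, Instr.Legal, Instr.result, State.setNat, State.setReal, h9, hf.target, hyy]
        using hne
    · rw [← hy, hyA]
      simp [resultList, Instr.result, State.setNat, State.setReal, h9, hf.target, hyy, hf.amount,
        div_eq_mul_inv]
  refine ((laplacianProgram_spec G c x y k).seq fun s hs => (h1 s hs).seq fun s hs =>
    (HaltsWithin.loop (VertexInvariant x y k h) (fun l s h => ⟨h.vertex, h.fixed.size⟩)
      (fun l s hl h => vertexBody_spec hl h) hs).seq h2).mono ?_ fun _ h => h
  -- The cost is linear in `m` for the Laplacian and cubic in `N` for the elimination; the factor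
  -- `100` leaves ample room.
  have : (N + m + 1) ^ 3 = N ^ 3 + m ^ 3 + 1 + 3 * N ^ 2 * m + 3 * N ^ 2 + 3 * m ^ 2 * N +
      3 * m ^ 2 + 3 * N + 3 * m + 6 * N * m := by ring
  rw [this]
  ring_nf
  have : 0 ≤ N * m := by positivity
  have : 0 ≤ N ^ 2 * m := by positivity
  nlinarith [Nat.zero_le N, Nat.zero_le m, Nat.zero_le (m ^ 3), Nat.zero_le (m ^ 2),
    Nat.zero_le (N * m ^ 2), Nat.zero_le (N ^ 2), Nat.zero_le (N ^ 3)]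

end RealRAM

end

theorem mainTheorem6 :
    (∀ (V E : Type*) [Fintype V] [Fintype E] (n : ℕ) (_ : Fintype.card V = n + 1)
      (G : CreditNetwork.MGraph V E) (c : E → ℝ) (_ : ∀ e, 0 ≤ c e) (_ : 0 < G.treeGen c)
      (D : E → Fin n → ℝ) (_ : G.IsSpanningRepresentation D) (x y : V) (_ : x ≠ y),
      (∀ k : ℝ, 0 ≤ k → ∃ d : ℝ,
        HasDerivWithinAt (CreditNetwork.failProb G D c x y) d (Set.Ici k) k ∧
          0 ≤ d ∧ d ≤ (G.identify x y).treeGen c / G.treeGen c) ∧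
      (∀ k : ℝ, 0 < k → ∃ d : ℝ,
        HasDerivWithinAt (CreditNetwork.failProb G D c x y) d (Set.Iic k) k ∧
          0 ≤ d ∧ d ≤ (G.identify x y).treeGen c / G.treeGen c) ∧
      (∃ K : ℝ, 0 < K ∧ IsLeast {k : ℝ | 0 ≤ k ∧ CreditNetwork.failProb G D c x y k = 1} K ∧
        ∀ k : ℝ, 0 < k → k ≠ K → DifferentiableAt ℝ (CreditNetwork.failProb G D c x y) k) ∧
      HasDerivWithinAt (CreditNetwork.failProb G D c x y)
        ((G.identify x y).treeGen c / G.treeGen c) (Set.Ici 0) 0 ∧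
      (∀ k : ℝ, 0 ≤ k →
        1 - k * ((G.identify x y).treeGen c / G.treeGen c) ≤
          CreditNetwork.successProb G D c x y k)) ∧
    (∃ (P : RealRAM.Program) (T : Polynomial ℕ),
      ∀ (N m : ℕ) (G : CreditNetwork.MGraph (Fin N) (Fin m)) (c : Fin m → ℝ)
        (_ : ∀ e, 0 ≤ c e) (_ : 0 < G.treeGen c) (x y : Fin N) (_ : x ≠ y) (k : ℝ) (_ : 0 ≤ k),
        ∃ (s : RealRAM.State) (t : ℕ), RealRAM.Runs P (RealRAM.input G c x y k) s t ∧
          t ≤ T.eval (N + m) ∧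
          s.realReg 0 = 1 - k * ((G.identify x y).treeGen c / G.treeGen c)) := by
  refine ⟨fun V E _ _ n hn G c hc hpos D hD x y hxy =>
    CreditNetwork.failProb_properties hn hc hpos hD hxy,
    RealRAM.boundProgram, 100 * (Polynomial.X + 1) ^ 3, fun N m G c hc hpos x y hxy k _ => ?_⟩
  simpa [RealRAM.HaltsWithin] using RealRAM.boundProgram_spec G hc hpos hxy k
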